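/- All graphs are finite and simple. A proper coloring $\varphi\colon V(G)\to\{1,\dots,k\}$ is a *b-coloring of $G$ with $k$ colors* if for every color $i$ there is a vertex $x$ with $\varphi(x)=i$ that has, for each color $j\ne i$, a neighbor of color $j$. Let $\Delta(G)$ be the maximum degree of $G$, and let $m(G)$ be the largest integer $i$ such that $G$ has at least $i$ vertices of degree at least $i-1$. **Theorem.** There is an algorithm that, given a graph $G$ on $n$ vertices, decides whether $G$ has a b-coloring with $k=m(G)$ colors in time $$2^{O(k^4\cdot\Delta(G))}+n^{O(1)},$$ and hence in time $2^{O(\Delta(G)^5)}+n^{O(1)}$. In particular, the problem is fixed-parameter tractable parameterized by $\Delta(G)$: it can be decided in time $f(\Delta(G))\cdot|G|^{c}$ for some computable function $f$ and some constant $c$, where $|G|$ is the size of the input. Here an algorithm is a single program of a random-access machine with unit-cost addition, truncated subtraction, comparison and indirect addressing, whose input is $n$ together with the adjacency matrix of $G$; the constants hidden in $O(\cdot)$ are absolute, and $n^{O(1)}$ stands for a bound $c\,(n^{c}+1)$ with a constant $c$. -/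

import Mathlib

namespace BCol

/-! ### b-colorings and the m-degree -/

/-- A proper coloring with the colors `Fin k` is a b-coloring if every color `i` has a
b-vertex: a vertex of color `i` with a neighbor of every other color. -/
def IsBColoring {V : Type*} {G : SimpleGraph V} {k : ℕ} (φ : G.Coloring (Fin k)) : Prop :=
  ∀ i : Fin k, ∃ x : V, φ x = i ∧ ∀ j : Fin k, j ≠ i → ∃ y : V, G.Adj x y ∧ φ y = j

/-- `G` has a b-coloring with `k` colors. -/
def HasBColoring {V : Type*} (G : SimpleGraph V) (k : ℕ) : Prop :=
  ∃ φ : G.Coloring (Fin k), IsBColoring φ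

open Classical in
/-- The number of vertices of degree at least `i - 1`
(written `i ≤ degree + 1`, to avoid truncated subtraction). -/
noncomputable def numDegGe {V : Type*} [Fintype V] (G : SimpleGraph V) (i : ℕ) : ℕ :=
  (Finset.univ.filter fun v : V => i ≤ G.degree v + 1).card

/-- The m-degree `m(G)`: the largest `i` such that `G` has (at least) `i` vertices of degree at
least `i - 1`. -/
noncomputable def mDegree {V : Type*} [Fintype V] (G : SimpleGraph V) : ℕ :=
  sSup {i : ℕ | i ≤ numDegGe G i}

/-- The supremum in the definition of the m-degree is a maximum. -/
theorem isGreatest_mDegree {V : Type*} [Fintype V] (G : SimpleGraph V) :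
    IsGreatest {i : ℕ | i ≤ numDegGe G i} (mDegree G) := by
  have hb : BddAbove {i : ℕ | i ≤ numDegGe G i} :=
    ⟨Fintype.card V, fun i hi => le_trans hi (Finset.card_le_univ _)⟩
  exact ⟨Nat.sSup_mem ⟨0, Nat.zero_le _⟩ hb, fun i hi => le_csSup hb hi⟩

open Classical in
/-- The maximum degree `Δ(G)` (it is `0` for the graph without vertices). -/
noncomputable def maxDeg {V : Type*} [Fintype V] (G : SimpleGraph V) : ℕ :=
  G.maxDegree

/-! ### Random-access machines -/

/-- Memory of a random-access machine: registers `reg x` and unbounded arrays `arr a`, with cells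
`arr a i`, all holding natural numbers. A program mentions only finitely many registers and
arrays. -/
structure State where
  reg : ℕ → ℕ
  arr : ℕ → ℕ → ℕ

/-- Write the value `v` into register `x`. -/
def State.setReg (s : State) (x v : ℕ) : State :=
  { s with reg := Function.update s.reg x v }

/-- Write the value `v` into cell `i` of array `a`. -/
def State.setArr (s : State) (a i v : ℕ) : State :=
  { s with arr := Function.update s.arr a (Function.update (s.arr a) i v) }

/-- Programs of a random-access machine, with structured control flow. Register names, array names
and constants are fixed by the program; only array indices are computed (indirect addressing).
The arithmetic consists of addition and truncated subtraction, so that unit cost is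
polynomially equivalent to time on Turing machines. -/
inductive Prog where
  /-- do nothing -/
  | skip : Prog
  /-- `x := c` for a constant `c` -/
  | const (x c : ℕ) : Prog
  /-- `x := y + z` -/
  | add (x y z : ℕ) : Prog
  /-- `x := y - z` (truncated) -/
  | sub (x y z : ℕ) : Prog
  /-- `x := a[y]` -/
  | load (x a y : ℕ) : Prog
  /-- `a[x] := y` -/
  | store (a x y : ℕ) : Prog
  /-- `p ; q` -/
  | seq (p q : Prog) : Prog
  /-- `if x < y then p else q` -/
  | ite (x y : ℕ) (p q : Prog) : Prog
  /-- `while x < y do p` -/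
  | loop (x y : ℕ) (p : Prog) : Prog

/-- `Runs p s t s'`: program `p`, started in memory `s`, halts after exactly `t` steps in
memory `s'`. Every elementary instruction and every evaluation of a test is one step. -/
inductive Runs : Prog → State → ℕ → State → Prop where
  | skip (s : State) : Runs .skip s 1 s
  | const (x c : ℕ) (s : State) : Runs (.const x c) s 1 (s.setReg x c)
  | add (x y z : ℕ) (s : State) : Runs (.add x y z) s 1 (s.setReg x (s.reg y + s.reg z))
  | sub (x y z : ℕ) (s : State) : Runs (.sub x y z) s 1 (s.setReg x (s.reg y - s.reg z))
  | load (x a y : ℕ) (s : State) : Runs (.load x a y) s 1 (s.setReg x (s.arr a (s.reg y)))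
  | store (a x y : ℕ) (s : State) : Runs (.store a x y) s 1 (s.setArr a (s.reg x) (s.reg y))
  | seq {p q : Prog} {s s' s'' : State} {t t' : ℕ} :
      Runs p s t s' → Runs q s' t' s'' → Runs (.seq p q) s (t + t') s''
  | ite_true {x y : ℕ} {p q : Prog} {s s' : State} {t : ℕ} :
      s.reg x < s.reg y → Runs p s t s' → Runs (.ite x y p q) s (t + 1) s'
  | ite_false {x y : ℕ} {p q : Prog} {s s' : State} {t : ℕ} :
      ¬ s.reg x < s.reg y → Runs q s t s' → Runs (.ite x y p q) s (t + 1) s'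
  | loop_done {x y : ℕ} {p : Prog} {s : State} :
      ¬ s.reg x < s.reg y → Runs (.loop x y p) s 1 s
  | loop_step {x y : ℕ} {p : Prog} {s s' s'' : State} {t t' : ℕ} :
      s.reg x < s.reg y → Runs p s t s' → Runs (.loop x y p) s' t' s'' →
      Runs (.loop x y p) s (t + t' + 1) s''

open Classical in
/-- The initial memory on input a graph `G` with vertex set `{0, …, n - 1}`: register `0` holds `n`,
array `0` holds the adjacency matrix row by row, and everything else is zero. -/
noncomputable def inputState {n : ℕ} (G : SimpleGraph (Fin n)) : State where
  reg x := if x = 0 then n else 0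
  arr a i := if a = 0 ∧ ∃ u v : Fin n, i = (u : ℕ) * n + (v : ℕ) ∧ G.Adj u v then 1 else 0

/-- The number of memory cells that the input occupies: the adjacency matrix and `n`. -/
def inputSize {n : ℕ} (_G : SimpleGraph (Fin n)) : ℕ := n ^ 2 + 1

/-- On every input graph `G`, the program `p` halts after at most `T G` steps, with the answer to
the question whether `Q G` holds (`1` for yes, `0` for no) in register `0`. -/
def DecidesInTime (p : Prog) (Q : ∀ {n : ℕ}, SimpleGraph (Fin n) → Prop)
    (T : ∀ {n : ℕ}, SimpleGraph (Fin n) → ℕ) : Prop :=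
  ∀ (n : ℕ) (G : SimpleGraph (Fin n)), ∃ (t : ℕ) (s : State),
    Runs p (inputState G) t s ∧ t ≤ T G ∧ (Q G → s.reg 0 = 1) ∧ (¬ Q G → s.reg 0 = 0)

/-- The graph problem `Q`, parameterized by `κ`, is fixed-parameter tractable: it is decided in
time `f(κ(G)) · |G| ^ c` for a computable function `f` and a constant `c`, where `|G|` is the
size of the input. -/
def IsFPT (Q : ∀ {n : ℕ}, SimpleGraph (Fin n) → Prop)
    (κ : ∀ {n : ℕ}, SimpleGraph (Fin n) → ℕ) : Prop :=
  ∃ (p : Prog) (f : ℕ → ℕ) (c : ℕ), Computable f ∧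
    DecidesInTime p Q (fun G => f (κ G) * inputSize G ^ c)

end BCol

/-! ### Bounds for polynomials with natural coefficients. -/

namespace BCol
open Polynomial

/-! Write k = m(G) and Δ = Δ(G). Then k ≤ Δ + 1, and by maximality of k at most k vertices have
degree at least k (`card_high_degree_le`). Vertices of degree less than k can be colored greedily at
the end, so it suffices to find a partial proper coloring that covers the vertices of degree at
least k and contains a b-vertex of every color (`IsCert.hasBColoring`).

Let D be the set of vertices of degree at least k - 1; every b-vertex lies in D. If |D| > 2(Δ+1)^4,
the answer is always yes (`hasBColoring_of_card`): k vertices of D can be chosen far from each other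
and from all vertices of degree at least k, and their closed neighborhoods can be colored
bijectively without interference. Otherwise a certificate needs only the b-vertices, one neighbor of
each per color, and the vertices of degree at least k (`HasBColoring.exists_lists`). These are 2k²
entries from at most 2(Δ+1)^5 candidates, so 12(Δ+1)k² bits encode a certificate, and all bit
strings can be tried.

On the machine side, `PT` means time polynomial in the magnitude of the numbers, not in their
length. It is closed under bounded sums and bounded quantifiers, so programs for the search follow
from the shape of its definition. The number 2^bits need not be polynomial in n; it is computed
separately by `runs_doubling` and passed on as a variable. The whole run is then polynomial in n +
2^bits, which `mul_add_pow_le` splits into two summands. -/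

theorem eval_mono_nat (q : ℕ[X]) : Monotone fun N : ℕ => q.eval N := by
  intro a b h
  induction q using Polynomial.induction_on' with
  | add p q hp hq => simpa using add_le_add hp hq
  | monomial n c => simpa using Nat.mul_le_mul_left c (Nat.pow_le_pow_left h n)

/-- Turns the polynomial bounds produced by `PT` into a bound governed by a single constant, as the
final running time requires. -/
theorem eval_le_pow (q : ℕ[X]) : ∃ c, ∀ N : ℕ, q.eval N ≤ c * (N + 1) ^ c := by
  induction q using Polynomial.induction_on' with
  | add p q hp hq =>
    obtain ⟨a, ha⟩ := hp
    obtain ⟨b, hb⟩ := hq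
    refine ⟨a + b, fun N => ?_⟩
    have h1 : (N + 1) ^ a ≤ (N + 1) ^ (a + b) := Nat.pow_le_pow_right (by omega) (by omega)
    have h2 : (N + 1) ^ b ≤ (N + 1) ^ (a + b) := Nat.pow_le_pow_right (by omega) (by omega)
    rw [eval_add, add_mul]
    exact add_le_add ((ha N).trans (Nat.mul_le_mul_left _ h1))
      ((hb N).trans (Nat.mul_le_mul_left _ h2))
  | monomial n c =>
    refine ⟨c + n, fun N => ?_⟩
    rw [eval_monomial]
    exact Nat.mul_le_mul (by omega) ((Nat.pow_le_pow_left (by omega) n).trans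
      (Nat.pow_le_pow_right (by omega) (by omega)))

/-! ### Functions computed by programs in polynomial time -/

/-- Contexts: finite tuples of natural numbers, the variables of a computation. -/
class Ctx (Γ : Type) where
  size : ℕ
  get : Γ → ℕ → ℕ

instance : Ctx ℕ := ⟨1, fun x _ => x⟩

/-- The newest variable gets the highest index, so the indices of older variables are stable under
extension. -/
instance {Γ : Type} [Ctx Γ] : Ctx (Γ × ℕ) :=
  ⟨Ctx.size Γ + 1, fun p i => if i = Ctx.size Γ then p.2 else Ctx.get p.1 i⟩

variable {Γ : Type} [Ctx Γ]

/-- All entries of the array `A` and all variables in the context are at most `N`. -/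
def Bdd (N : ℕ) (A : ℕ → ℕ) (γ : Γ) : Prop :=
  (∀ i, A i ≤ N) ∧ ∀ i < Ctx.size Γ, Ctx.get γ i ≤ N

/-- The memory `s` holds the array `A` and, in the registers given by `π`, the variables `γ`. -/
def Holds (π : ℕ → ℕ) (A : ℕ → ℕ) (γ : Γ) (s : State) : Prop :=
  s.arr 0 = A ∧ ∀ i < Ctx.size Γ, s.reg (π i) = Ctx.get γ i

/-- `p` computes the value `v` into register `d` within `T` steps, leaving the registers below `d`
and the arrays unchanged. -/
def Yields (p : Prog) (s : State) (d v T : ℕ) : Prop :=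
  ∃ t s', Runs p s t s' ∧ t ≤ T ∧ s'.reg d = v ∧ (∀ i < d, s'.reg i = s.reg i) ∧ s'.arr = s.arr

/-- `f` is computed by a program in time polynomial in the numbers involved; the program works
with any placement `π` of the variables below the result register `d`. -/
def PT (f : (ℕ → ℕ) → Γ → ℕ) : Prop :=
  ∃ q : ℕ[X], (∀ N A γ, Bdd N A γ → f A γ ≤ q.eval N) ∧
    ∀ (π : ℕ → ℕ) (d : ℕ), (∀ i < Ctx.size Γ, π i < d) → ∃ p : Prog, ∀ N A γ s,
      Bdd N A γ → Holds π A γ s → Yields p s d (f A γ) (q.eval N)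

theorem Holds.congr {π : ℕ → ℕ} {A : ℕ → ℕ} {γ : Γ} {s s' : State} {d : ℕ}
    (h : Holds π A γ s) (hπ : ∀ i < Ctx.size Γ, π i < d) (hr : ∀ i < d, s'.reg i = s.reg i)
    (ha : s'.arr = s.arr) : Holds π A γ s' :=
  ⟨by rw [ha]; exact h.1, fun i hi => by rw [hr _ (hπ i hi)]; exact h.2 i hi⟩

/-- Binding a variable costs no instruction: the placement is simply pointed at a register that
already holds the value. -/
theorem Holds.extend {π : ℕ → ℕ} {A : ℕ → ℕ} {γ : Γ} {s : State} {x : ℕ} (h : Holds π A γ s)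
    (y : ℕ) (hx : s.reg x = y) : Holds (Function.update π (Ctx.size Γ) x) A (γ, y) s := by
  refine ⟨h.1, fun i hi => ?_⟩
  change i < Ctx.size Γ + 1 at hi
  change _ = if i = Ctx.size Γ then y else Ctx.get γ i
  split_ifs with hc
  · subst hc; simpa using hx
  · rw [Function.update_of_ne hc]; exact h.2 i (by omega)

theorem Bdd.mono {N M : ℕ} {A : ℕ → ℕ} {γ : Γ} (h : Bdd N A γ) (hNM : N ≤ M) : Bdd M A γ :=
  ⟨fun i => (h.1 i).trans hNM, fun i hi => (h.2 i hi).trans hNM⟩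

theorem Bdd.extend {N : ℕ} {A : ℕ → ℕ} {γ : Γ} (h : Bdd N A γ) {y : ℕ} (hy : y ≤ N) :
    Bdd N A (γ, y) := by
  refine ⟨h.1, fun i hi => ?_⟩
  change i < Ctx.size Γ + 1 at hi
  change (if i = Ctx.size Γ then y else Ctx.get γ i) ≤ _
  split_ifs with hc
  · exact hy
  · exact h.2 i (by omega)

theorem lt_update {π : ℕ → ℕ} {d e x : ℕ} (hπ : ∀ i < Ctx.size Γ, π i < d) (hd : d ≤ e)
    (hx : x < e) : ∀ i < Ctx.size (Γ × ℕ), Function.update π (Ctx.size Γ) x i < e := by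
  intro i hi
  change i < Ctx.size Γ + 1 at hi
  by_cases hc : i = Ctx.size Γ
  · subst hc; simpa using hx
  · rw [Function.update_of_ne hc]; exact (hπ i (by omega)).trans_le hd

/-! ### Elementary functions, composition and iteration. -/

theorem PT.const (c : ℕ) : PT fun (_ : ℕ → ℕ) (_ : Γ) => c :=
  ⟨C (c + 1), fun N A γ _ => by simp, fun π d _ => ⟨.const d c, fun N A γ s _ _ =>
    ⟨1, _, Runs.const _ _ _, by simp, by simp [State.setReg], fun i hi => by
      simp [State.setReg, hi.ne], rfl⟩⟩⟩

theorem PT.nat : PT fun (_ : ℕ → ℕ) (x : ℕ) => x := by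
  refine ⟨X + 2, fun N A γ h => ?_, fun π d hπ => ⟨.seq (.const d 0) (.add d (π 0) d),
    fun N A γ s _ hs => ⟨1 + 1, _, Runs.seq (Runs.const _ _ _) (Runs.add _ _ _ _), by simp, ?_,
      fun i hi => by simp [State.setReg, hi.ne], rfl⟩⟩⟩
  · have := h.2 0 Nat.one_pos
    change γ ≤ N at this
    simp; omega
  · have := hs.2 0 Nat.one_pos
    change _ = γ at this
    have h0 := hπ 0 Nat.one_pos
    simp [State.setReg, h0.ne, this]

theorem PT.snd : PT fun (_ : ℕ → ℕ) (x : Γ × ℕ) => x.2 := by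
  refine ⟨X + 2, fun N A γ h => ?_, fun π d hπ => ⟨.seq (.const d 0) (.add d (π (Ctx.size Γ)) d),
    fun N A γ s _ hs => ⟨1 + 1, _, Runs.seq (Runs.const _ _ _) (Runs.add _ _ _ _), by simp, ?_,
      fun i hi => by simp [State.setReg, hi.ne], rfl⟩⟩⟩
  · have := h.2 (Ctx.size Γ) (Nat.lt_succ_self _)
    change (if _ then _ else _) ≤ N at this
    simp at this
    simp; omega
  · have := hs.2 (Ctx.size Γ) (Nat.lt_succ_self _)
    change _ = (if _ then _ else _) at this
    have h0 := hπ (Ctx.size Γ) (Nat.lt_succ_self _)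
    simp at this
    simp [State.setReg, h0.ne, this]

theorem PT.weaken {f : (ℕ → ℕ) → Γ → ℕ} (hf : PT f) :
    PT fun A (x : Γ × ℕ) => f A x.1 := by
  obtain ⟨q, hq, hp⟩ := hf
  have key : ∀ (x : Γ × ℕ), ∀ i < Ctx.size Γ, Ctx.get x i = Ctx.get x.1 i := fun x i hi => by
    change (if _ then _ else _) = _
    rw [if_neg hi.ne]
  have hb : ∀ N A (x : Γ × ℕ), Bdd N A x → Bdd N A x.1 := fun N A x h =>
    ⟨h.1, fun i hi => key x i hi ▸ h.2 i (Nat.lt_succ_of_lt hi)⟩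
  refine ⟨q, fun N A γ h => hq N A _ (hb N A γ h), fun π d hπ => ?_⟩
  obtain ⟨p, hp⟩ := hp π d fun i hi => hπ i (Nat.lt_succ_of_lt hi)
  exact ⟨p, fun N A γ s h hs => hp N A _ s (hb N A γ h)
    ⟨hs.1, fun i hi => key γ i hi ▸ hs.2 i (Nat.lt_succ_of_lt hi)⟩⟩

theorem Yields.mono {p : Prog} {s : State} {d v T T' : ℕ} (h : Yields p s d v T) (hT : T ≤ T') :
    Yields p s d v T' := by
  obtain ⟨t, s', h1, h2, h3⟩ := h
  exact ⟨t, s', h1, h2.trans hT, h3⟩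

/-- Sequencing: run `p` into register `d`, then a program that may use its result. -/
theorem Yields.seq {p p' : Prog} {s : State} {d v w T T' : ℕ} (h : Yields p s d v T)
    (h' : ∀ s', s'.reg d = v → (∀ i < d, s'.reg i = s.reg i) → s'.arr = s.arr →
      Yields p' s' d w T') : Yields (.seq p p') s d w (T + T') := by
  obtain ⟨t, s', h1, h2, h3, h4, h5⟩ := h
  obtain ⟨t', s'', g1, g2, g3, g4, g5⟩ := h' s' h3 h4 h5
  exact ⟨t + t', s'', h1.seq g1, add_le_add h2 g2, g3, fun i hi => (g4 i hi).trans (h4 i hi),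
    g5.trans h5⟩

/-- Evaluate two functions and apply one more instruction to their values. -/
theorem PT.comp₂ {f g : (ℕ → ℕ) → Γ → ℕ} (hf : PT f) (hg : PT g) (h : (ℕ → ℕ) → Γ → ℕ)
    (hle : ∃ q : ℕ[X], ∀ N A γ, Bdd N A γ → h A γ ≤ q.eval N) (op : ℕ → Prog)
    (hop : ∀ d A γ s, s.arr 0 = A → s.reg d = f A γ → s.reg (d + 1) = g A γ →
      Yields (op d) s d (h A γ) 1) : PT h := by
  obtain ⟨q₁, hq₁, hp₁⟩ := hf
  obtain ⟨q₂, hq₂, hp₂⟩ := hg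
  obtain ⟨q, hq⟩ := hle
  refine ⟨q₁ + q₂ + 1 + q, fun N A γ hb => (hq N A γ hb).trans (by simp), fun π d hπ => ?_⟩
  obtain ⟨p₁, hp₁⟩ := hp₁ π d hπ
  obtain ⟨p₂, hp₂⟩ := hp₂ π (d + 1) fun i hi => Nat.lt_succ_of_lt (hπ i hi)
  refine ⟨.seq p₁ (.seq p₂ (op d)), fun N A γ s hb hs => ?_⟩
  refine ((hp₁ N A γ s hb hs).seq (T' := q₂.eval N + 1) fun s₁ h1 h2 h3 => ?_).mono
    (by simp; omega)
  obtain ⟨t, s₂, r, ht, k1, k2, k3⟩ := hp₂ N A γ s₁ hb (hs.congr hπ h2 h3)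
  obtain ⟨t', s₃, r', ht', l1, l2, l3⟩ := hop d A γ s₂ (by rw [k3, h3, hs.1])
    (by rw [k2 d (by omega), h1]) k1
  exact ⟨_, _, r.seq r', add_le_add ht ht', l1,
    fun i hi => (l2 i hi).trans (k2 i (by omega)), l3.trans k3⟩

theorem PT.add {f g : (ℕ → ℕ) → Γ → ℕ} (hf : PT f) (hg : PT g) :
    PT fun A γ => f A γ + g A γ := by
  refine hf.comp₂ hg _ ?_ (fun d => .add d d (d + 1)) fun d A γ s _ h1 h2 =>
    ⟨1, _, Runs.add _ _ _ _, le_rfl, by simp [State.setReg, h1, h2], fun i hi => by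
      simp [State.setReg, hi.ne], rfl⟩
  obtain ⟨q₁, hq₁, -⟩ := hf
  obtain ⟨q₂, hq₂, -⟩ := hg
  exact ⟨q₁ + q₂, fun N A γ hb => by
    rw [eval_add]; exact add_le_add (hq₁ N A γ hb) (hq₂ N A γ hb)⟩

theorem PT.sub {f g : (ℕ → ℕ) → Γ → ℕ} (hf : PT f) (hg : PT g) :
    PT fun A γ => f A γ - g A γ := by
  refine hf.comp₂ hg _ ?_ (fun d => .sub d d (d + 1)) fun d A γ s _ h1 h2 =>
    ⟨1, _, Runs.sub _ _ _ _, le_rfl, by simp [State.setReg, h1, h2], fun i hi => by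
      simp [State.setReg, hi.ne], rfl⟩
  obtain ⟨q₁, hq₁, -⟩ := hf
  exact ⟨q₁, fun N A γ hb => (Nat.sub_le _ _).trans (hq₁ N A γ hb)⟩

theorem PT.arr {f : (ℕ → ℕ) → Γ → ℕ} (hf : PT f) : PT fun A γ => A (f A γ) :=
  hf.comp₂ hf _ ⟨X, fun N A γ hb => by simpa using hb.1 _⟩ (fun d => .load d 0 d)
    fun d A γ s h0 h1 _ => ⟨1, _, Runs.load _ _ _ _, le_rfl, by simp [State.setReg, h0, h1],
      fun i hi => by simp [State.setReg, hi.ne], rfl⟩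

open Classical in
theorem PT.ite_lt {f g u v : (ℕ → ℕ) → Γ → ℕ} (hf : PT f) (hg : PT g) (hu : PT u) (hv : PT v) :
    PT fun A γ => if f A γ < g A γ then u A γ else v A γ := by
  obtain ⟨q₁, -, hp₁⟩ := hf
  obtain ⟨q₂, -, hp₂⟩ := hg
  obtain ⟨q₃, hq₃, hp₃⟩ := hu
  obtain ⟨q₄, hq₄, hp₄⟩ := hv
  refine ⟨q₁ + (q₂ + (q₃ + q₄ + 1)), fun N A γ hb => ?_, fun π d hπ => ?_⟩
  · have := hq₃ N A γ hb
    have := hq₄ N A γ hb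
    simp
    split_ifs <;> omega
  obtain ⟨p₁, hp₁⟩ := hp₁ π d hπ
  obtain ⟨p₂, hp₂⟩ := hp₂ π (d + 1) fun i hi => Nat.lt_succ_of_lt (hπ i hi)
  obtain ⟨p₃, hp₃⟩ := hp₃ π d hπ
  obtain ⟨p₄, hp₄⟩ := hp₄ π d hπ
  refine ⟨.seq p₁ (.seq p₂ (.ite d (d + 1) p₃ p₄)), fun N A γ s hb hs => ?_⟩
  rw [eval_add]
  refine (hp₁ N A γ s hb hs).seq fun s₁ h1 h2 h3 => ?_
  obtain ⟨t, s₂, r, ht, k1, k2, k3⟩ := hp₂ N A γ s₁ hb (hs.congr hπ h2 h3)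
  have hs₂ : Holds π A γ s₂ := (hs.congr hπ h2 h3).congr hπ (fun i hi => k2 i (by omega)) k3
  have h1' : s₂.reg d = f A γ := by rw [k2 d (by omega), h1]
  by_cases hc : f A γ < g A γ
  · obtain ⟨t', s₃, r', ht', l1, l2, l3⟩ := hp₃ N A γ s₂ hb hs₂
    exact ⟨_, _, r.seq (Runs.ite_true (by rwa [h1', k1]) r'), by simp; omega, by simp [l1, hc],
      fun i hi => (l2 i hi).trans (k2 i (by omega)), l3.trans k3⟩
  · obtain ⟨t', s₃, r', ht', l1, l2, l3⟩ := hp₄ N A γ s₂ hb hs₂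
    exact ⟨_, _, r.seq (Runs.ite_false (by rwa [h1', k1]) r'), by simp; omega, by simp [l1, hc],
      fun i hi => (l2 i hi).trans (k2 i (by omega)), l3.trans k3⟩

/-- Iteration with a counter and an accumulator. -/
def iter (init : ℕ) (body : ℕ → ℕ → ℕ) (m : ℕ) : ℕ :=
  Nat.rec init (fun i acc => body i acc) m

/-- The bound `hle` on all intermediate values is essential: iterating a polynomially bounded body,
such as doubling, can produce exponentially large numbers. -/
theorem PT.fold {m init : (ℕ → ℕ) → Γ → ℕ} {body : (ℕ → ℕ) → Γ → ℕ → ℕ → ℕ} (hm : PT m)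
    (hi : PT init) (hbody : PT fun A (x : (Γ × ℕ) × ℕ) => body A x.1.1 x.1.2 x.2)
    (hle : ∃ q : ℕ[X], ∀ N A γ, Bdd N A γ → ∀ j ≤ m A γ,
      iter (init A γ) (body A γ) j ≤ q.eval N) :
    PT fun A γ => iter (init A γ) (body A γ) (m A γ) := by
  obtain ⟨q₁, -, hp₁⟩ := hi
  obtain ⟨q₂, hq₂, hp₂⟩ := hm
  obtain ⟨q₃, -, hp₃⟩ := hbody
  obtain ⟨q, hq⟩ := hle
  -- The body also sees the counter, at most `q₂`, and the accumulator, at most `q`; `r` bounds the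
  -- time of one round of the body.
  set r : ℕ[X] := q₃.comp (X + q₂ + q) with hr
  refine ⟨q + (q₁ + (q₂ + (3 + (q₂ * (r + 3) + 1)))), fun N A γ hb => ?_, fun π d hπ => ?_⟩
  · exact (hq N A γ hb _ le_rfl).trans (by simp)
  obtain ⟨p₁, hp₁⟩ := hp₁ π d hπ
  obtain ⟨p₂, hp₂⟩ := hp₂ π (d + 1) fun i hi => Nat.lt_succ_of_lt (hπ i hi)
  -- Layout: `d` accumulator, `d + 1` number of rounds, `d + 2` counter, `d + 3` the constant 1, `d
  -- + 4` the constant 0 (used to copy by addition), `d + 5` result of the body.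
  obtain ⟨p₃, hp₃⟩ := hp₃ (Function.update (Function.update π (Ctx.size Γ) (d + 2))
    (Ctx.size (Γ × ℕ)) d) (d + 5)
    (lt_update (d := d + 5) (lt_update hπ (by omega) (by omega)) le_rfl (by omega))
  refine ⟨.seq p₁ (.seq p₂ (.seq (.seq (.const (d + 2) 0) (.seq (.const (d + 3) 1)
    (.const (d + 4) 0))) (.loop (d + 2) (d + 1) (.seq p₃ (.seq (.add d (d + 5) (d + 4))
      (.add (d + 2) (d + 2) (d + 3))))))), fun N A γ s hb hs => ?_⟩
  -- The loop invariant, by induction on the number `k` of remaining rounds.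
  have loop : ∀ k i s', i + k = m A γ → s'.reg d = iter (init A γ) (body A γ) i →
      s'.reg (d + 1) = m A γ → s'.reg (d + 2) = i → s'.reg (d + 3) = 1 → s'.reg (d + 4) = 0 →
      Holds π A γ s' → ∃ t s'', Runs (.loop (d + 2) (d + 1) (.seq p₃ (.seq (.add d (d + 5) (d + 4))
        (.add (d + 2) (d + 2) (d + 3))))) s' t s'' ∧ t ≤ k * (r.eval N + 3) + 1 ∧
        s''.reg d = iter (init A γ) (body A γ) (m A γ) ∧ (∀ i < d, s''.reg i = s'.reg i) ∧
        s''.arr = s'.arr := by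
    intro k
    induction k with
    | zero =>
      intro i s' hk h0 h1 h2 h3 h4 h5
      exact ⟨1, s', Runs.loop_done (by rw [h2, h1]; omega), by omega, by rw [h0]; congr 1,
        fun _ _ => rfl, rfl⟩
    | succ k ih =>
      intro i s' hk h0 h1 h2 h3 h4 h5
      have hb' : Bdd ((X + q₂ + q).eval N) A ((γ, i), s'.reg d) := by
        have e1 := hq₂ N A γ hb
        have e2 := hq N A γ hb i (by omega)
        refine Bdd.extend (Bdd.extend (hb.mono ?_) ?_) ?_
        · simp; omega
        · simp; omega
        · rw [h0]; simp; omega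
      obtain ⟨t, s₁, r₁, ht, k1, k2, k3⟩ := hp₃ _ A ((γ, i), s'.reg d) s' hb'
        ((h5.extend i h2).extend _ rfl)
      have e0 : d ≠ d + 2 := by omega
      obtain ⟨t', s₂, r₂, ht', l1, l2, l3⟩ := ih (i + 1)
        ((s₁.setReg d (s₁.reg (d + 5) + s₁.reg (d + 4))).setReg (d + 2)
          ((s₁.setReg d (s₁.reg (d + 5) + s₁.reg (d + 4))).reg (d + 2) +
            (s₁.setReg d (s₁.reg (d + 5) + s₁.reg (d + 4))).reg (d + 3))) (by omega)
        (by simp only [State.setReg, Function.update_of_ne e0, Function.update_self]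
            rw [k1, k2 (d + 4) (by omega), h4, h0]; rfl)
        (by simp [State.setReg]; rw [k2 (d + 1) (by omega), h1])
        (by simp [State.setReg]; rw [k2 (d + 2) (by omega), k2 (d + 3) (by omega), h2, h3])
        (by simp [State.setReg]; rw [k2 (d + 3) (by omega), h3])
        (by simp [State.setReg]; rw [k2 (d + 4) (by omega), h4])
        (h5.congr hπ (fun j hj => by
          have a1 : j ≠ d := by omega
          have a2 : j ≠ d + 2 := by omega
          simp only [State.setReg, Function.update_of_ne a1, Function.update_of_ne a2]
          exact k2 j (by omega)) k3)
      refine ⟨_, s₂, Runs.loop_step (by rw [h1, h2]; omega)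
        (r₁.seq ((Runs.add _ _ _ _).seq (Runs.add _ _ _ _))) r₂, ?_, l1, fun j hj => ?_, ?_⟩
      · have : q₃.eval ((X + q₂ + q).eval N) = r.eval N := by rw [hr, eval_comp]
        rw [this] at ht
        rw [add_mul]
        omega
      · rw [l2 j hj]
        have a1 : j ≠ d := by omega
        have a2 : j ≠ d + 2 := by omega
        simp only [State.setReg, Function.update_of_ne a1, Function.update_of_ne a2]
        exact k2 j (by omega)
      · rw [l3]; exact k3
  refine ((hp₁ N A γ s hb hs).seq (T' := q₂.eval N + (3 + (q₂.eval N * (r.eval N + 3) + 1)))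
    fun s₁ h1 h2 h3 => ?_).mono (by simp)
  have hs₁ := hs.congr hπ h2 h3
  obtain ⟨t, s₂, r₂, ht, k1, k2, k3⟩ := hp₂ N A γ s₁ hb hs₁
  have hs₂ : Holds π A γ s₂ := hs₁.congr hπ (fun i hi => k2 i (by omega)) k3
  obtain ⟨t', s₃, r₃, ht', l1, l2, l3⟩ := loop (m A γ) 0
    (((s₂.setReg (d + 2) 0).setReg (d + 3) 1).setReg (d + 4) 0) (by omega)
    (by simp [State.setReg, iter]; rw [k2 d (by omega), h1])
    (by simp [State.setReg, k1]) (by simp [State.setReg]) (by simp [State.setReg])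
    (by simp [State.setReg]) (hs₂.congr hπ (fun j hj => by
          have a1 : j ≠ d + 2 := by omega
          have a2 : j ≠ d + 3 := by omega
          have a3 : j ≠ d + 4 := by omega
          simp [State.setReg, a1, a2, a3]) rfl)
  refine ⟨_, s₃, r₂.seq (((Runs.const _ _ _).seq ((Runs.const _ _ _).seq
    (Runs.const _ _ _))).seq r₃), ?_, l1, fun j hj => ?_, ?_⟩
  · have := Nat.mul_le_mul_right (r.eval N + 3) (hq₂ N A γ hb)
    omega
  · rw [l2 j hj]
    have a1 : j ≠ d + 2 := by omega
    have a2 : j ≠ d + 3 := by omega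
    have a3 : j ≠ d + 4 := by omega
    simp only [State.setReg, Function.update_of_ne a1, Function.update_of_ne a2,
      Function.update_of_ne a3]
    exact k2 j (by omega)
  · rw [l3]; exact k3

theorem PT.sum {m : (ℕ → ℕ) → Γ → ℕ} {f : (ℕ → ℕ) → Γ → ℕ → ℕ} (hm : PT m)
    (hf : PT fun A (x : Γ × ℕ) => f A x.1 x.2) :
    PT fun A γ => ∑ i ∈ Finset.range (m A γ), f A γ i := by
  have key : ∀ A γ j, iter 0 (fun i acc => acc + f A γ i) j = ∑ i ∈ Finset.range j, f A γ i := by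
    intro A γ j
    induction j with
    | zero => rfl
    | succ j ih => rw [Finset.sum_range_succ, ← ih]; rfl
  have := PT.fold (m := m) (init := fun _ _ => 0)
    (body := fun A γ i acc => acc + f A γ i) hm (PT.const 0) (PT.snd.add hf.weaken) ?_
  · simpa only [key] using this
  · obtain ⟨q₁, hq₁, -⟩ := hm
    obtain ⟨q₂, hq₂, -⟩ := hf
    refine ⟨q₁ * q₂.comp (X + q₁), fun N A γ hb j hj => ?_⟩
    have h1 := hq₁ N A γ hb
    rw [key, eval_mul, eval_comp]
    refine (Finset.sum_le_card_nsmul _ _ (q₂.eval ((X + q₁).eval N)) fun i hi => ?_).trans ?_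
    · have hi' := Finset.mem_range.1 hi
      exact hq₂ _ A (γ, i) (Bdd.extend (hb.mono (by simp)) (by simp; omega))
    · rw [Finset.card_range, smul_eq_mul]
      exact Nat.mul_le_mul_right _ (hj.trans h1)

/-- Repeated addition is affordable because time is measured against the values of the numbers. -/
theorem PT.mul {f g : (ℕ → ℕ) → Γ → ℕ} (hf : PT f) (hg : PT g) :
    PT fun A γ => f A γ * g A γ := by
  simpa using hf.sum (f := fun A γ _ => g A γ) hg.weaken

/-! ### Decidable predicates, bounded quantifiers, counting and division. -/

open Classical in
/-- The predicate `P` is decided by a program in time polynomial in the numbers involved. -/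
def PTP (P : (ℕ → ℕ) → Γ → Prop) : Prop := PT fun A γ => if P A γ then 1 else 0

theorem PT.ite {P : (ℕ → ℕ) → Γ → Prop} [∀ A γ, Decidable (P A γ)]
    {u v : (ℕ → ℕ) → Γ → ℕ} (hP : PTP P) (hu : PT u)
    (hv : PT v) : PT fun A γ => if P A γ then u A γ else v A γ := by
  have h := (PT.const 0).ite_lt hP hu hv
  convert h using 4 with A γ
  by_cases hc : P A γ <;> simp [hc]

theorem PTP.lt {f g : (ℕ → ℕ) → Γ → ℕ} (hf : PT f) (hg : PT g) :
    PTP fun A γ => f A γ < g A γ := by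
  have h := hf.ite_lt hg (PT.const 1) (PT.const 0)
  unfold PTP
  convert h

open Classical in
theorem PTP.not {P : (ℕ → ℕ) → Γ → Prop} (hP : PTP P) : PTP fun A γ => ¬ P A γ := by
  have h := PT.ite hP (PT.const 0) (PT.const 1)
  unfold PTP
  convert h using 3 with A γ
  by_cases hc : P A γ <;> simp [hc]

open Classical in
theorem PTP.and {P Q : (ℕ → ℕ) → Γ → Prop} (hP : PTP P) (hQ : PTP Q) :
    PTP fun A γ => P A γ ∧ Q A γ := by
  have h := PT.ite hP hQ (PT.const 0)
  unfold PTP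
  convert h using 3 with A γ
  by_cases hc : P A γ <;> simp [hc]

open Classical in
theorem PTP.or {P Q : (ℕ → ℕ) → Γ → Prop} (hP : PTP P) (hQ : PTP Q) :
    PTP fun A γ => P A γ ∨ Q A γ := by
  have h := PT.ite hP (PT.const 1) hQ
  unfold PTP
  convert h using 3 with A γ
  by_cases hc : P A γ <;> simp [hc]

theorem PTP.imp {P Q : (ℕ → ℕ) → Γ → Prop} (hP : PTP P) (hQ : PTP Q) :
    PTP fun A γ => P A γ → Q A γ := by
  simpa only [imp_iff_not_or] using hP.not.or hQ

theorem PTP.le {f g : (ℕ → ℕ) → Γ → ℕ} (hf : PT f) (hg : PT g) :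
    PTP fun A γ => f A γ ≤ g A γ := by
  simpa only [not_lt] using (PTP.lt hg hf).not

theorem PTP.eq {f g : (ℕ → ℕ) → Γ → ℕ} (hf : PT f) (hg : PT g) :
    PTP fun A γ => f A γ = g A γ := by
  simpa only [← le_antisymm_iff] using (PTP.le hf hg).and (PTP.le hg hf)

/-- A witness exists exactly when the sum of the indicators is positive; the search is exhaustive.
-/
theorem PTP.exists_lt {m : (ℕ → ℕ) → Γ → ℕ} {P : (ℕ → ℕ) → Γ → ℕ → Prop} (hm : PT m)
    (hP : PTP fun A (x : Γ × ℕ) => P A x.1 x.2) : PTP fun A γ => ∃ i < m A γ, P A γ i := by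
  classical
  have h := PTP.lt (PT.const 0) (hm.sum (f := fun A γ i => if P A γ i then 1 else 0) (by
    unfold PTP at hP; convert hP))
  convert h using 3 with A γ
  simp [Finset.sum_boole, Finset.card_pos, Finset.Nonempty]

theorem PTP.forall_lt {m : (ℕ → ℕ) → Γ → ℕ} {P : (ℕ → ℕ) → Γ → ℕ → Prop} (hm : PT m)
    (hP : PTP fun A (x : Γ × ℕ) => P A x.1 x.2) : PTP fun A γ => ∀ i < m A γ, P A γ i := by
  have h := (PTP.exists_lt (P := fun A γ i => ¬ P A γ i) hm hP.not).not
  simpa only [not_exists, not_and, not_not] using h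

theorem PT.count {m : (ℕ → ℕ) → Γ → ℕ} {P : (ℕ → ℕ) → Γ → ℕ → Prop}
    [∀ A γ i, Decidable (P A γ i)] (hm : PT m)
    (hP : PTP fun A (x : Γ × ℕ) => P A x.1 x.2) :
    PT fun A γ => ((Finset.range (m A γ)).filter fun i => P A γ i).card := by
  have h := hm.sum (f := fun A γ i => if P A γ i then 1 else 0) (by unfold PTP at hP; convert hP)
  simpa only [Finset.sum_boole, Nat.cast_id] using h

theorem PT.div {f g : (ℕ → ℕ) → Γ → ℕ} (hf : PT f) (hg : PT g) :
    PT fun A γ => f A γ / g A γ := by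
  classical
  -- The quotient counts the positive multiples of the divisor that are at most the dividend.
  -- Divisor 0 is treated apart: all multiples would qualify, whereas the quotient is 0 by
  -- convention.
  have h := PT.ite (PTP.lt (PT.const 0) hg) (PT.count (P := fun A γ i => (i + 1) * g A γ ≤ f A γ) hf
    (PTP.le ((PT.snd.add (PT.const 1)).mul hg.weaken) hf.weaken)) (PT.const 0)
  convert h using 3 with A γ
  split_ifs with h0
  · symm
    have : ((Finset.range (f A γ)).filter fun i => (i + 1) * g A γ ≤ f A γ) =
        Finset.range (f A γ / g A γ) := by
      ext i
      simp only [Finset.mem_filter, Finset.mem_range]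
      rw [← Nat.le_div_iff_mul_le h0]
      have := Nat.div_le_self (f A γ) (g A γ)
      omega
    rw [this, Finset.card_range]
  · simp [show g A γ = 0 by omega]

theorem PT.mod {f g : (ℕ → ℕ) → Γ → ℕ} (hf : PT f) (hg : PT g) :
    PT fun A γ => f A γ % g A γ := by
  have h := hf.sub (hg.mul (hf.div hg))
  convert h using 3 with A γ
  have := Nat.mod_add_div (f A γ) (g A γ)
  omega

/-- Powers of two can be computed as long as they do not exceed a given number. -/
theorem PT.min_two_pow {f g : (ℕ → ℕ) → Γ → ℕ} (hf : PT f) (hg : PT g) :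
    PT fun A γ => min (2 ^ f A γ) (g A γ) := by
  classical
  -- Capping at `c` after each doubling keeps every intermediate value bounded, and yields the same
  -- result as capping once at the end.
  have key : ∀ c j, iter (min 1 c) (fun _ acc => if c < acc + acc then c else acc + acc) j
      = min (2 ^ j) c := by
    intro c j
    induction j with
    | zero => rfl
    | succ j ih =>
      change (if c < iter _ _ j + iter _ _ j then c else iter _ _ j + iter _ _ j) = _
      rw [ih, pow_succ]
      split_ifs <;> omega
  have := PT.fold (m := f) (init := fun A γ => min 1 (g A γ))
    (body := fun A γ _ acc => if g A γ < acc + acc then g A γ else acc + acc) hf ?_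
    (PT.ite (PTP.lt hg.weaken.weaken (PT.snd.add PT.snd)) hg.weaken.weaken
      (PT.snd.add PT.snd)) ?_
  · simpa only [key] using this
  · have h := PT.ite (PTP.lt hg (PT.const 1)) hg (PT.const 1)
    convert h using 3 with A γ
    split_ifs <;> omega
  · obtain ⟨q, hq, -⟩ := hg
    exact ⟨q, fun N A γ hb j _ => by
      simp only [key]; exact (min_le_right _ _).trans (hq N A γ hb)⟩

end BCol

namespace BCol
open Classical

/-! ### Certificates, greedy extension, and graphs with many vertices of degree at least k - 1. -/

section Graph

variable {V : Type*} [Fintype V] {G : SimpleGraph V} {k : ℕ}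

/-- A partial proper coloring, given as a relation, in which every color has a b-vertex and every
vertex of degree at least `k` is colored. -/
def IsCert (G : SimpleGraph V) (C : V → Fin k → Prop) : Prop :=
  (∀ v j j', C v j → C v j' → j = j') ∧ (∀ u v j, G.Adj u v → C u j → ¬ C v j) ∧
    (∀ j, ∃ v, C v j ∧ ∀ j', j' ≠ j → ∃ u, G.Adj v u ∧ C u j') ∧
    ∀ v, k ≤ G.degree v → ∃ j, C v j

/-- A partial proper coloring whose uncolored vertices have degree less than the number of colors
extends greedily to a proper coloring. -/
theorem exists_coloring_extending (m : ℕ) : ∀ c : V → Option (Fin k),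
    (Finset.univ.filter fun v => c v = none).card = m →
    (∀ u v j, G.Adj u v → c u = some j → c v ≠ some j) → (∀ v, c v = none → G.degree v < k) →
    ∃ φ : G.Coloring (Fin k), ∀ v j, c v = some j → φ v = j := by
  induction m with
  | zero =>
    intro c hc hp _
    have h : ∀ v, c v ≠ none := by
      intro v hv
      have : v ∈ Finset.univ.filter fun v => c v = none := by simpa using hv
      rw [Finset.card_eq_zero.1 hc] at this
      simp at this
    choose f hf using fun v => Option.ne_none_iff_exists'.1 (h v)
    refine ⟨SimpleGraph.Coloring.mk f fun {u v} huv he => hp u v (f u) huv (hf u) ?_,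
      fun v j hj => ?_⟩
    · rw [hf v, he]
    · rw [hf v] at hj
      exact Option.some.inj hj
  | succ m ih =>
    intro c hc hp hd
    obtain ⟨v, hv⟩ := Finset.card_pos.1 ((Nat.succ_pos m).trans_eq hc.symm)
    have hv' : c v = none := by simpa using hv
    -- Pigeonhole: `v` has fewer than `k` neighbors, so some color is free at `v`.
    obtain ⟨j, hj⟩ : ∃ j : Fin k, ∀ u, G.Adj v u → c u ≠ some j := by
      by_contra! hcon
      have hsub : Finset.univ.map (Function.Embedding.some (α := Fin k)) ⊆
          (G.neighborFinset v).image c := by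
        intro x hx
        obtain ⟨j, -, rfl⟩ := Finset.mem_map.1 hx
        obtain ⟨u, hu, hcu⟩ := hcon j
        exact Finset.mem_image.2 ⟨u, by simpa using hu, hcu⟩
      have h1 := (Finset.card_le_card hsub).trans Finset.card_image_le
      rw [Finset.card_map, Finset.card_univ, Fintype.card_fin,
        SimpleGraph.card_neighborFinset_eq_degree] at h1
      exact absurd (hd v hv') (by omega)
    have hcard : (Finset.univ.filter fun u => Function.update c v (some j) u = none).card = m := by
      have : (Finset.univ.filter fun u => Function.update c v (some j) u = none) =
          (Finset.univ.filter fun u => c u = none).erase v := by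
        ext u
        by_cases hu : u = v
        · subst hu; simp
        · simp [hu]
      rw [this, Finset.card_erase_of_mem hv, hc, Nat.add_sub_cancel]
    have hproper : ∀ u w i, G.Adj u w → Function.update c v (some j) u = some i →
        Function.update c v (some j) w ≠ some i := by
      intro u w i huw
      by_cases hu : u = v
      · subst hu
        rw [Function.update_self, Function.update_of_ne huw.ne']
        rintro hi
        cases hi
        exact hj w huw
      · rw [Function.update_of_ne hu]
        by_cases hw : w = v
        · subst hw
          rw [Function.update_self]
          intro h1 h2
          cases h2
          exact hj u huw.symm h1
        · rw [Function.update_of_ne hw]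
          exact hp u w i huw
    have hdeg : ∀ u, Function.update c v (some j) u = none → G.degree u < k := by
      intro u hu
      by_cases huv : u = v
      · subst huv; simp at hu
      · rw [Function.update_of_ne huv] at hu
        exact hd u hu
    obtain ⟨φ, hφ⟩ := ih _ hcard hproper hdeg
    refine ⟨φ, fun u i hu => hφ u i ?_⟩
    have : u ≠ v := by rintro rfl; simp [hv'] at hu
    rwa [Function.update_of_ne this]

/-- Uncolored vertices have degree less than `k`, so greedy extension applies. It keeps the colors
already assigned, so the b-vertices of the certificate remain b-vertices. -/
theorem IsCert.hasBColoring {C : V → Fin k → Prop} (h : IsCert G C) : HasBColoring G k := by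
  obtain ⟨h1, h2, h3, h4⟩ := h
  have key : ∀ v j, (if h : ∃ j, C v j then some h.choose else none) = some j ↔ C v j := by
    intro v j
    split_ifs with hv
    · rw [Option.some_inj]
      exact ⟨fun e => e ▸ hv.choose_spec, h1 _ _ _ hv.choose_spec⟩
    · simpa using fun hj => hv ⟨j, hj⟩
  obtain ⟨φ, hφ⟩ := exists_coloring_extending (G := G) _
    (fun v => if h : ∃ j, C v j then some h.choose else none) rfl
    (fun u v j huv => by
      simp only [ne_eq, key]
      exact h2 u v j huv)
    (fun v hv => by
      by_contra hd
      obtain ⟨j, hj⟩ := h4 v (not_lt.1 hd)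
      have := (key v j).2 hj
      simp only [hv] at this
      cases this)
  replace hφ : ∀ v j, C v j → φ v = j := fun v j hj => hφ v j ((key v j).2 hj)
  refine ⟨φ, fun i => ?_⟩
  obtain ⟨v, hv, hn⟩ := h3 i
  refine ⟨v, hφ v i hv, fun j hj => ?_⟩
  obtain ⟨u, hu, huj⟩ := hn j hj
  exact ⟨u, hu, hφ u j huj⟩

/-- A b-coloring restricts to a certificate in which every color class has a list of at most
`k + k` vertices, each of degree at least `k - 1` or adjacent to such a vertex. -/
theorem HasBColoring.exists_lists (h : HasBColoring G k)
    (hH : (Finset.univ.filter fun v => k ≤ G.degree v).card ≤ k) :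
    ∃ w : Fin k → Fin (k + k) → V,
      (∀ j i, k ≤ G.degree (w j i) + 1 ∨ ∃ u, G.Adj (w j i) u ∧ k ≤ G.degree u + 1) ∧
      IsCert G fun v j => ∃ i, w j i = v := by
  obtain ⟨φ, hφ⟩ := h
  choose x hx hy using hφ
  choose y hadj hcol using hy
  -- All `k` colors occur in the closed neighborhood of a b-vertex.
  have hdeg : ∀ i, k ≤ G.degree (x i) + 1 := by
    intro i
    have : (Finset.univ : Finset (Fin k)) ⊆ insert i ((G.neighborFinset (x i)).image φ) := by
      intro j _
      by_cases hj : j = i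
      · simp [hj]
      · exact Finset.mem_insert_of_mem (Finset.mem_image.2
          ⟨y i j hj, by simpa using hadj i j hj, hcol i j hj⟩)
    have h1 := (Finset.card_le_card this).trans ((Finset.card_insert_le _ _).trans
      (Nat.succ_le_succ Finset.card_image_le))
    simpa using h1
  obtain ⟨g⟩ : Nonempty ({v // k ≤ G.degree v} ↪ Fin k) :=
    Function.Embedding.nonempty_of_card_le (by
      rw [Fintype.card_fin, Fintype.card_subtype]; exact hH)
  -- The list of color `j`: on the left, the b-vertex of color `j` and, for each other color `i`,
  -- the color-`j` neighbor of the b-vertex of color `i`; on the right, the vertices of degree at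
  -- least `k` that have color `j`, in the slots given by `g`. Unused slots repeat `x j`.
  let w : Fin k → Fin k ⊕ Fin k → V := fun j => Sum.elim
    (fun i => if h : j = i then x i else y i j h)
    (fun r => if h : ∃ v, g v = r ∧ φ v = j then h.choose else x j)
  have hwφ : ∀ j i, φ (w j i) = j := by
    rintro j (i | r)
    · simp only [w, Sum.elim_inl]
      split_ifs with h
      · rw [h, hx]
      · exact hcol _ _ _
    · simp only [w, Sum.elim_inr]
      split_ifs with h
      · exact h.choose_spec.2
      · exact hx j
  have hwW : ∀ j i, k ≤ G.degree (w j i) + 1 ∨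
      ∃ u, G.Adj (w j i) u ∧ k ≤ G.degree u + 1 := by
    rintro j (i | r)
    · by_cases h : j = i
      · have e : w j (Sum.inl i) = x i := dif_pos h
        rw [e]
        exact Or.inl (hdeg _)
      · have e : w j (Sum.inl i) = y i j h := dif_neg h
        rw [e]
        exact Or.inr ⟨x i, (hadj _ _ _).symm, hdeg i⟩
    · by_cases h : ∃ v, g v = r ∧ φ v = j
      · have e : w j (Sum.inr r) = h.choose := dif_pos h
        rw [e]
        exact Or.inl (Nat.le_succ_of_le h.choose.2)
      · have e : w j (Sum.inr r) = x j := dif_neg h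
        rw [e]
        exact Or.inl (hdeg _)
  have hC : IsCert G fun v j => ∃ i, w j i = v := by
    refine ⟨?_, ?_, fun j => ⟨x j, ⟨Sum.inl j, by simp [w]⟩, fun j' hj' =>
      ⟨y j j' hj', hadj _ _ _, Sum.inl j, by simp [w, hj']⟩⟩, fun v hv => ?_⟩
    · rintro v j j' ⟨i, rfl⟩ ⟨i', h⟩
      rw [← hwφ j i, ← h, hwφ]
    · rintro u v j huv ⟨i, rfl⟩ ⟨i', rfl⟩
      exact φ.valid huv (by rw [hwφ, hwφ])
    · have hex : ∃ v', g v' = g ⟨v, hv⟩ ∧ φ v' = φ v := ⟨⟨v, hv⟩, rfl, rfl⟩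
      refine ⟨φ v, Sum.inr (g ⟨v, hv⟩), ?_⟩
      simp only [w, Sum.elim_inr, dif_pos hex]
      rw [g.injective hex.choose_spec.1]
  refine ⟨fun j i => w j (finSumFinEquiv.symm i), fun j i => hwW _ _, ?_⟩
  convert hC using 3 with v j
  exact ⟨fun ⟨i, hi⟩ => ⟨_, hi⟩, fun ⟨i, hi⟩ => ⟨finSumFinEquiv i, by simpa using hi⟩⟩

/-- The closed neighborhood of a set of vertices. -/
noncomputable def nbhd (G : SimpleGraph V) (S : Finset V) : Finset V :=
  S.biUnion fun v => insert v (G.neighborFinset v)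

theorem mem_nbhd {S : Finset V} {v : V} : v ∈ nbhd G S ↔ ∃ u ∈ S, v = u ∨ G.Adj u v := by
  simp [nbhd]

theorem card_nbhd_le {Δ : ℕ} (hΔ : ∀ v, G.degree v ≤ Δ) (S : Finset V) :
    (nbhd G S).card ≤ S.card * (Δ + 1) :=
  Finset.card_biUnion_le_card_mul _ _ _ fun v _ => (Finset.card_insert_le _ _).trans
    (by simpa using hΔ v)

/-- Among sufficiently many vertices one finds `m` vertices at pairwise distance at least four. -/
theorem exists_scattered {Δ : ℕ} (hΔ : ∀ v, G.degree v ≤ Δ) (D : Finset V) (m : ℕ)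
    (hD : m * (Δ + 1) ^ 3 < D.card) :
    ∃ X ⊆ D, X.card = m ∧ ∀ u ∈ X, ∀ v ∈ X, u ≠ v →
      ∀ a b, (a = u ∨ G.Adj u a) → (b = a ∨ G.Adj a b) → ¬ (v = b ∨ G.Adj b v) := by
  induction m with
  | zero => exact ⟨∅, by simp, rfl, by simp⟩
  | succ m ih =>
    obtain ⟨X, hXD, hX, hfar⟩ := ih (lt_of_le_of_lt (Nat.mul_le_mul_right _ (by omega)) hD)
    -- The ball of radius three around `X` has at most `m * (Δ + 1) ^ 3` vertices and so cannot
    -- cover `D`.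
    obtain ⟨y, hyD, hy⟩ : ∃ y ∈ D, y ∉ nbhd G (nbhd G (nbhd G X)) := by
      apply Finset.exists_mem_notMem_of_card_lt_card
      refine lt_of_le_of_lt ?_ hD
      calc _ ≤ X.card * (Δ + 1) * (Δ + 1) * (Δ + 1) :=
            (card_nbhd_le hΔ _).trans (Nat.mul_le_mul_right _ ((card_nbhd_le hΔ _).trans
              (Nat.mul_le_mul_right _ (card_nbhd_le hΔ _))))
        _ ≤ _ := by rw [hX, mul_assoc, mul_assoc]; exact Nat.mul_le_mul (by omega) (by ring_nf; rfl)
    have hfar' : ∀ u ∈ X, ∀ a b, (a = u ∨ G.Adj u a) → (b = a ∨ G.Adj a b) →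
        ¬ (y = b ∨ G.Adj b y) := fun u hu a b h1 h2 h3 =>
      hy (mem_nbhd.2 ⟨b, mem_nbhd.2 ⟨a, mem_nbhd.2 ⟨u, hu, h1⟩, h2⟩, h3⟩)
    have hyX : y ∉ X := fun h => hfar' y h y y (Or.inl rfl) (Or.inl rfl) (Or.inl rfl)
    refine ⟨insert y X, Finset.insert_subset hyD hXD, by rw [Finset.card_insert_of_notMem hyX, hX],
      ?_⟩
    intro u hu v hv huv a b h1 h2 h3
    rcases Finset.mem_insert.1 hu with hu' | hu'
    · rw [hu'] at h1
      rcases Finset.mem_insert.1 hv with hv' | hv'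
      · exact huv (hu'.trans hv'.symm)
      · exact hfar' v hv' b a (h3.imp Eq.symm SimpleGraph.Adj.symm)
          (h2.imp Eq.symm SimpleGraph.Adj.symm) (h1.imp Eq.symm SimpleGraph.Adj.symm)
    · rcases Finset.mem_insert.1 hv with hv' | hv'
      · rw [hv'] at h3
        exact hfar' u hu' a b h1 h2 h3
      · exact hfar u hu' v hv' huv a b h1 h2 h3

/-- The closed neighborhood of a vertex of degree `k - 1` can be colored bijectively, with a
prescribed color for its center. -/
theorem exists_bijective_coloring (v : V) (hv : G.degree v + 1 = k) (i : Fin k) :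
    ∃ f : V → Fin k, f v = i ∧
      Set.InjOn f (insert v (G.neighborFinset v) : Finset V) ∧
      ∀ j, ∃ u ∈ insert v (G.neighborFinset v), f u = j := by
  have hc : (insert v (G.neighborFinset v)).card = k := by
    rw [Finset.card_insert_of_notMem (by simp), SimpleGraph.card_neighborFinset_eq_degree, hv]
  let e := (Finset.equivFinOfCardEq hc)
  -- The transposition moves the color of the center to `i`.
  let σ := e.trans (Equiv.swap (e ⟨v, by simp⟩) i)
  refine ⟨fun u => if h : u ∈ insert v (G.neighborFinset v) then σ ⟨u, h⟩ else i, ?_, ?_, ?_⟩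
  · beta_reduce
    rw [dif_pos (Finset.mem_insert_self _ _)]
    simp [σ]
  · intro a ha b hb hab
    rw [Finset.mem_coe] at ha hb
    simp only [dif_pos ha, dif_pos hb] at hab
    exact congrArg Subtype.val (σ.injective hab)
  · intro j
    refine ⟨σ.symm j, (σ.symm j).2, ?_⟩
    beta_reduce
    rw [dif_pos (σ.symm j).2]
    simp

/-- With sufficiently many vertices of degree at least `k - 1`, of which at most `k` have larger
degree, there is a b-coloring. -/
theorem hasBColoring_of_card {Δ : ℕ} (hΔ : ∀ v, G.degree v ≤ Δ) (hk : k ≤ Δ + 1)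
    (hH : (Finset.univ.filter fun v => k ≤ G.degree v).card ≤ k)
    (hD : 2 * (Δ + 1) ^ 4 < (Finset.univ.filter fun v => k ≤ G.degree v + 1).card) :
    HasBColoring G k := by
  set H := Finset.univ.filter fun v => k ≤ G.degree v with hHdef
  set D := Finset.univ.filter fun v => k ≤ G.degree v + 1 with hDdef
  have hcl : (nbhd G (nbhd G H)).card ≤ (Δ + 1) ^ 4 := by
    calc _ ≤ H.card * (Δ + 1) * (Δ + 1) :=
          (card_nbhd_le hΔ _).trans (Nat.mul_le_mul_right _ (card_nbhd_le hΔ _))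
      _ ≤ (Δ + 1) * (Δ + 1) * (Δ + 1) :=
          Nat.mul_le_mul_right _ (Nat.mul_le_mul_right _ (hH.trans hk))
      _ = (Δ + 1) ^ 3 := by ring
      _ ≤ _ := Nat.pow_le_pow_right (by omega) (by omega)
  -- Removing the ball of radius two around `H` costs at most `(Δ + 1) ^ 4` vertices; the more than
  -- `(Δ + 1) ^ 4` that remain exceed the threshold `k * (Δ + 1) ^ 3`.
  obtain ⟨X, hXD, hX, hfar⟩ := exists_scattered hΔ (D \ nbhd G (nbhd G H)) k (by
    have h1 : k * (Δ + 1) ^ 3 ≤ (Δ + 1) ^ 4 :=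
      (Nat.mul_le_mul_right _ hk).trans (le_of_eq (by ring))
    have := Finset.le_card_sdiff (nbhd G (nbhd G H)) D
    omega)
  let x : Fin k → V := fun i => ((Finset.equivFinOfCardEq hX).symm i : V)
  have hxX : ∀ i, x i ∈ X := fun i => ((Finset.equivFinOfCardEq hX).symm i).2
  have hxinj : Function.Injective x :=
    Subtype.val_injective.comp (Finset.equivFinOfCardEq hX).symm.injective
  have hxH : ∀ i a b, (a = x i ∨ G.Adj (x i) a) → (b = a ∨ G.Adj a b) → b ∉ H := by
    intro i a b h1 h2 hb
    refine (Finset.mem_sdiff.1 (hXD (hxX i))).2 (mem_nbhd.2 ⟨a, mem_nbhd.2 ⟨b, hb, ?_⟩, ?_⟩)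
    · exact h2.imp Eq.symm SimpleGraph.Adj.symm
    · exact h1.imp Eq.symm SimpleGraph.Adj.symm
  have hdeg : ∀ i, G.degree (x i) + 1 = k := by
    intro i
    have h1 : k ≤ G.degree (x i) + 1 :=
      (Finset.mem_filter.1 (Finset.mem_sdiff.1 (hXD (hxX i))).1).2
    have h2 : ¬ k ≤ G.degree (x i) := fun h => hxH i _ _ (Or.inl rfl) (Or.inl rfl)
      (Finset.mem_filter.2 ⟨Finset.mem_univ _, h⟩)
    omega
  choose f hfx hfinj hfsurj using fun i => exists_bijective_coloring (x i) (hdeg i) i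
  obtain ⟨g⟩ : Nonempty (H ↪ Fin k) := Function.Embedding.nonempty_of_card_le (by
    rw [Fintype.card_fin, Fintype.card_coe]; exact hH)
  have mem : ∀ i v, v ∈ insert (x i) (G.neighborFinset (x i)) ↔ v = x i ∨ G.Adj (x i) v := by simp
  -- Pairwise distance at least four: closed neighborhoods of different centers neither meet nor are
  -- joined by an edge.
  have huniq : ∀ i i' a b, (a = x i ∨ G.Adj (x i) a) → (b = x i' ∨ G.Adj (x i') b) →
      (b = a ∨ G.Adj a b) → i = i' := by
    intro i i' a b h1 h2 h3
    by_contra hne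
    exact hfar _ (hxX i) _ (hxX i') (hxinj.ne hne) a b h1 h3
      (h2.imp Eq.symm SimpleGraph.Adj.symm)
  -- `H` gets pairwise different colors and each center's closed neighborhood a bijective coloring.
  -- By `hxH` and `huniq` no edge joins two of these pieces.
  refine IsCert.hasBColoring (C := fun v j => (∃ h : v ∈ H, g ⟨v, h⟩ = j) ∨
    ∃ i, (v = x i ∨ G.Adj (x i) v) ∧ f i v = j) ⟨?_, ?_, ?_, ?_⟩
  · rintro v j j' (⟨h, rfl⟩ | ⟨i, hi, rfl⟩) (⟨h', rfl⟩ | ⟨i', hi', rfl⟩)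
    · rfl
    · exact absurd h (hxH i' v v hi' (Or.inl rfl))
    · exact absurd h' (hxH i v v hi (Or.inl rfl))
    · rw [huniq i i' v v hi hi' (Or.inl rfl)]
  · rintro u v j huv (⟨h, hj⟩ | ⟨i, hi, rfl⟩) (⟨h', hj'⟩ | ⟨i', hi', hj'⟩)
    · exact huv.ne (congrArg Subtype.val (g.injective (hj.trans hj'.symm)))
    · exact hxH i' v u hi' (Or.inr huv.symm) h
    · exact hxH i u v hi (Or.inr huv) h'
    · obtain rfl := huniq i i' u v hi hi' (Or.inr huv)
      exact huv.ne (hfinj i ((mem i u).2 hi) ((mem i v).2 hi') hj'.symm)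
  · refine fun j => ⟨x j, Or.inr ⟨j, Or.inl rfl, hfx j⟩, fun j' hj' => ?_⟩
    obtain ⟨u, hu, huj⟩ := hfsurj j j'
    rcases (mem j u).1 hu with rfl | hu'
    · exact absurd (huj.symm.trans (hfx j)) hj'
    · exact ⟨u, hu', Or.inr ⟨j, Or.inr hu', huj⟩⟩
  · exact fun v hv => ⟨_, Or.inl ⟨Finset.mem_filter.2 ⟨Finset.mem_univ _, hv⟩, rfl⟩⟩

/-- Otherwise m(G) + 1 would also be admissible in the definition of m(G). -/
theorem card_high_degree_le (G : SimpleGraph V) :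
    (Finset.univ.filter fun v => mDegree G ≤ G.degree v).card ≤ mDegree G := by
  by_contra! h
  have : mDegree G + 1 ∈ {i : ℕ | i ≤ numDegGe G i} := by
    simpa [numDegGe, Nat.succ_le_iff] using h
  have := (isGreatest_mDegree G).2 this
  omega

theorem degree_le_maxDeg (G : SimpleGraph V) (v : V) : G.degree v ≤ maxDeg G :=
  G.degree_le_maxDegree v

theorem mDegree_le_maxDeg (G : SimpleGraph V) : mDegree G ≤ maxDeg G + 1 := by
  rcases Nat.eq_zero_or_pos (mDegree G) with h | h
  · omega
  · have h1 : mDegree G ≤ numDegGe G (mDegree G) := (isGreatest_mDegree G).1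
    obtain ⟨v, hv⟩ := Finset.card_pos.1 (h.trans_le h1)
    exact (Finset.mem_filter.1 hv).2.trans (Nat.succ_le_succ (degree_le_maxDeg G v))

end Graph

end BCol

namespace BCol
open Classical Polynomial

/-! ### The algorithm, as a function of the adjacency matrix `A` and the number of vertices `n` -/

namespace Alg

def adj (A : ℕ → ℕ) (n u v : ℕ) : Prop := 0 < A (u * n + v)

noncomputable def deg (A : ℕ → ℕ) (n v : ℕ) : ℕ :=
  ((Finset.range n).filter fun u => adj A n v u).card

noncomputable def numGe (A : ℕ → ℕ) (n i : ℕ) : ℕ :=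
  ((Finset.range n).filter fun v => i ≤ deg A n v + 1).card

/-- A maximum computed by counting: the admissible values form an initial segment, because `numGe`
decreases in its last argument. The same device gives `maxd`. -/
noncomputable def mdeg (A : ℕ → ℕ) (n : ℕ) : ℕ :=
  ((Finset.range n).filter fun i => i + 1 ≤ numGe A n (i + 1)).card

noncomputable def maxd (A : ℕ → ℕ) (n : ℕ) : ℕ :=
  ((Finset.range n).filter fun i => ∃ v < n, i + 1 ≤ deg A n v).card

/-- The vertices that may occur in a certificate. -/
def cand (A : ℕ → ℕ) (n v : ℕ) : Prop :=
  mdeg A n ≤ deg A n v + 1 ∨ ∃ u < n, adj A n v u ∧ mdeg A n ≤ deg A n u + 1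

/-- The position of a vertex in the list of candidates. -/
noncomputable def rank (A : ℕ → ℕ) (n v : ℕ) : ℕ :=
  ((Finset.range v).filter fun u => cand A n u).card

/-- The number of bits of a position in the list of candidates. -/
noncomputable def width (A : ℕ → ℕ) (n : ℕ) : ℕ := 6 * (maxd A n + 1)

/-- The number of bits of a certificate. -/
noncomputable def bits (A : ℕ → ℕ) (n : ℕ) : ℕ := width A n * ((mdeg A n + mdeg A n) * mdeg A n)

/-- The `j`-th entry of the certificate `t`; the powers of two needed are at most `P`. -/
noncomputable def digit (A : ℕ → ℕ) (n P t j : ℕ) : ℕ :=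
  t / min (2 ^ (width A n * j)) P % min (2 ^ width A n) P

/-- The certificate `t` gives vertex `v` color `j`. -/
def col (A : ℕ → ℕ) (n P t v j : ℕ) : Prop :=
  cand A n v ∧ ∃ i < mdeg A n + mdeg A n, digit A n P t (i * mdeg A n + j) = rank A n v

def check (A : ℕ → ℕ) (n P t : ℕ) : Prop :=
  (∀ v < n, ∀ j < mdeg A n, ∀ j' < mdeg A n, col A n P t v j → col A n P t v j' → j = j') ∧
  (∀ u < n, ∀ v < n, ∀ j < mdeg A n, adj A n u v → col A n P t u j → ¬ col A n P t v j) ∧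
  (∀ j < mdeg A n, ∃ v < n, col A n P t v j ∧
    ∀ j' < mdeg A n, ¬ j' = j → ∃ u < n, adj A n v u ∧ col A n P t u j') ∧
  ∀ v < n, mdeg A n ≤ deg A n v → ∃ j < mdeg A n, col A n P t v j

/-- The intended `P` is 2^bits. As a separate argument it lets both the range of the search and the
powers in `digit` count as polynomial. -/
def answer (A : ℕ → ℕ) (n P : ℕ) : Prop :=
  2 * ((maxd A n + 1) * (maxd A n + 1) * ((maxd A n + 1) * (maxd A n + 1))) < numGe A n (mdeg A n) ∨
    ∃ t < P, check A n P t

end Alg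

/-! ### Polynomial-time programs for the components of the algorithm. -/

section

variable {Γ : Type} [Ctx Γ] {n P t u v i j : (ℕ → ℕ) → Γ → ℕ}

theorem PTP.adj (hn : PT n) (hu : PT u) (hv : PT v) :
    PTP fun A γ => Alg.adj A (n A γ) (u A γ) (v A γ) :=
  PTP.lt (PT.const 0) ((hu.mul hn).add hv).arr

theorem PT.deg (hn : PT n) (hv : PT v) : PT fun A γ => Alg.deg A (n A γ) (v A γ) :=
  hn.count (P := fun A γ i => Alg.adj A (n A γ) (v A γ) i) (PTP.adj hn.weaken hv.weaken PT.snd)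

theorem PT.numGe (hn : PT n) (hi : PT i) : PT fun A γ => Alg.numGe A (n A γ) (i A γ) :=
  hn.count (P := fun A γ w => i A γ ≤ Alg.deg A (n A γ) w + 1)
    (PTP.le hi.weaken ((PT.deg hn.weaken PT.snd).add (PT.const 1)))

theorem PT.mdeg (hn : PT n) : PT fun A γ => Alg.mdeg A (n A γ) :=
  hn.count (P := fun A γ i => i + 1 ≤ Alg.numGe A (n A γ) (i + 1))
    (PTP.le (PT.snd.add (PT.const 1)) (PT.numGe hn.weaken (PT.snd.add (PT.const 1))))

theorem PT.maxd (hn : PT n) : PT fun A γ => Alg.maxd A (n A γ) :=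
  hn.count (P := fun A γ i => ∃ v < n A γ, i + 1 ≤ Alg.deg A (n A γ) v)
    (PTP.exists_lt (P := fun A (γ : Γ × ℕ) v => γ.2 + 1 ≤ Alg.deg A (n A γ.1) v) hn.weaken
      (PTP.le (PT.snd.weaken.add (PT.const 1)) (PT.deg hn.weaken.weaken PT.snd)))

theorem PTP.cand (hn : PT n) (hv : PT v) : PTP fun A γ => Alg.cand A (n A γ) (v A γ) :=
  (PTP.le hn.mdeg ((PT.deg hn hv).add (PT.const 1))).or
    (PTP.exists_lt (P := fun A γ w => Alg.adj A (n A γ) (v A γ) w ∧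
      Alg.mdeg A (n A γ) ≤ Alg.deg A (n A γ) w + 1) hn
      ((PTP.adj hn.weaken hv.weaken PT.snd).and
        (PTP.le hn.mdeg.weaken ((PT.deg hn.weaken PT.snd).add (PT.const 1)))))

theorem PT.rank (hn : PT n) (hv : PT v) : PT fun A γ => Alg.rank A (n A γ) (v A γ) :=
  hv.count (P := fun A γ w => Alg.cand A (n A γ) w) (PTP.cand hn.weaken PT.snd)

theorem PT.width (hn : PT n) : PT fun A γ => Alg.width A (n A γ) :=
  (PT.const 6).mul (hn.maxd.add (PT.const 1))

theorem PT.bits (hn : PT n) : PT fun A γ => Alg.bits A (n A γ) :=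
  hn.width.mul ((hn.mdeg.add hn.mdeg).mul hn.mdeg)

theorem PT.digit (hn : PT n) (hP : PT P) (ht : PT t) (hj : PT j) :
    PT fun A γ => Alg.digit A (n A γ) (P A γ) (t A γ) (j A γ) :=
  (ht.div ((hn.width.mul hj).min_two_pow hP)).mod (hn.width.min_two_pow hP)

theorem PTP.col (hn : PT n) (hP : PT P) (ht : PT t) (hv : PT v) (hj : PT j) :
    PTP fun A γ => Alg.col A (n A γ) (P A γ) (t A γ) (v A γ) (j A γ) :=
  (PTP.cand hn hv).and (PTP.exists_lt (P := fun A γ i =>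
    Alg.digit A (n A γ) (P A γ) (t A γ) (i * Alg.mdeg A (n A γ) + j A γ) =
      Alg.rank A (n A γ) (v A γ)) (hn.mdeg.add hn.mdeg)
    (PTP.eq (PT.digit hn.weaken hP.weaken ht.weaken
      ((PT.snd.mul hn.mdeg.weaken).add hj.weaken)) (PT.rank hn hv).weaken))

theorem PTP.check (hn : PT n) (hP : PT P) (ht : PT t) :
    PTP fun A γ => Alg.check A (n A γ) (P A γ) (t A γ) := by
  have h1 := hn.weaken (Γ := Γ)
  have h2 := h1.weaken
  have h3 := h2.weaken
  have p1 := hP.weaken (Γ := Γ)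
  have p2 := p1.weaken
  have p3 := p2.weaken
  have t1 := ht.weaken (Γ := Γ)
  have t2 := t1.weaken
  have t3 := t2.weaken
  refine (PTP.forall_lt hn ?_).and ((PTP.forall_lt hn ?_).and
    ((PTP.forall_lt hn.mdeg ?_).and (PTP.forall_lt hn ?_)))
  · refine PTP.forall_lt h1.mdeg (PTP.forall_lt h2.mdeg ?_)
    exact (PTP.col h3 p3 t3 PT.snd.weaken.weaken PT.snd.weaken).imp
      ((PTP.col h3 p3 t3 PT.snd.weaken.weaken PT.snd).imp (PTP.eq PT.snd.weaken PT.snd))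
  · refine PTP.forall_lt h1 (PTP.forall_lt h2.mdeg ?_)
    exact (PTP.adj h3 PT.snd.weaken.weaken PT.snd.weaken).imp
      ((PTP.col h3 p3 t3 PT.snd.weaken.weaken PT.snd).imp
        (PTP.col h3 p3 t3 PT.snd.weaken PT.snd).not)
  · refine PTP.exists_lt h1 ((PTP.col h2 p2 t2 PT.snd PT.snd.weaken).and
      (PTP.forall_lt h2.mdeg ((PTP.eq PT.snd PT.snd.weaken.weaken).not.imp
        (PTP.exists_lt h3 ?_))))
    exact (PTP.adj h3.weaken PT.snd.weaken.weaken PT.snd).and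
      (PTP.col h3.weaken p3.weaken t3.weaken PT.snd PT.snd.weaken)
  · exact (PTP.le h1.mdeg (PT.deg h1 PT.snd)).imp (PTP.exists_lt h1.mdeg
      (PTP.col h2 p2 t2 PT.snd.weaken PT.snd))

theorem PTP.answer (hn : PT n) (hP : PT P) : PTP fun A γ => Alg.answer A (n A γ) (P A γ) := by
  have hd := hn.maxd.add (PT.const 1)
  exact (PTP.lt ((PT.const 2).mul ((hd.mul hd).mul (hd.mul hd))) (PT.numGe hn hn.mdeg)).or
    (PTP.exists_lt hP (PTP.check hn.weaken hP.weaken PT.snd))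

end

/-! ### Correctness -/

section

variable {n : ℕ} (G : SimpleGraph (Fin n))

/-- The adjacency matrix of `G` as it is stored in memory. -/
noncomputable def matrix : ℕ → ℕ := (inputState G).arr 0

theorem matrix_le_one (i : ℕ) : matrix G i ≤ 1 := by
  change (if _ then _ else _) ≤ _
  split_ifs <;> simp

theorem adj_iff (u v : Fin n) : Alg.adj (matrix G) n u v ↔ G.Adj u v := by
  have : matrix G (u * n + v) = if G.Adj u v then 1 else 0 := by
    change (if _ then _ else _) = _
    congr 1
    simp only [true_and, eq_iff_iff]
    refine ⟨?_, fun h => ⟨u, v, rfl, h⟩⟩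
    rintro ⟨u', v', he, h⟩
    have hn : 0 < n := u.pos
    -- Quotient and remainder modulo `n` recover the row and the column of a cell.
    have e1 := congrArg (· / n) he
    have e2 := congrArg (· % n) he
    simp only [Nat.mul_comm _ n,
      Nat.mul_add_div hn, Nat.div_eq_of_lt v.2, Nat.div_eq_of_lt v'.2, Nat.add_zero,
      Nat.mul_add_mod, Nat.mod_eq_of_lt v.2, Nat.mod_eq_of_lt v'.2] at e1 e2
    rwa [Fin.ext e1, Fin.ext e2]
  rw [Alg.adj, this]
  split_ifs with h <;> simp [h]

theorem card_filter_range (p : ℕ → Prop) [DecidablePred p] :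
    ((Finset.range n).filter p).card = (Finset.univ.filter fun v : Fin n => p v).card := by
  rw [Finset.card_filter, Finset.card_filter, Finset.sum_range]

theorem deg_eq (v : Fin n) : Alg.deg (matrix G) n v = G.degree v := by
  rw [Alg.deg, card_filter_range, ← SimpleGraph.card_neighborFinset_eq_degree]
  congr 1
  ext u
  simp [adj_iff]

theorem numGe_eq (i : ℕ) : Alg.numGe (matrix G) n i = numDegGe G i := by
  rw [Alg.numGe, card_filter_range, numDegGe]
  simp [deg_eq]

theorem card_filter_range_lt {m n : ℕ} {p : ℕ → Prop} [DecidablePred p]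
    (h : ∀ i, i < n ∧ p i ↔ i < m) :
    ((Finset.range n).filter p).card = m := by
  rw [show (Finset.range n).filter p = Finset.range m by ext i; simp [h], Finset.card_range]

theorem mdeg_eq : Alg.mdeg (matrix G) n = mDegree G := by
  unfold Alg.mdeg
  refine card_filter_range_lt fun i => ?_
  rw [numGe_eq]
  constructor
  · exact fun h => (isGreatest_mDegree G).2 h.2
  · intro h
    have h1 : mDegree G ≤ numDegGe G (mDegree G) := (isGreatest_mDegree G).1
    have h2 : numDegGe G (mDegree G) ≤ numDegGe G (i + 1) :=
      Finset.card_le_card (Finset.monotone_filter_right _ fun v _ hv => (Nat.succ_le_of_lt h).trans hv)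
    have h3 : numDegGe G (mDegree G) ≤ n :=
      (Finset.card_le_univ _).trans_eq (Fintype.card_fin n)
    exact ⟨by omega, by omega⟩

theorem maxd_eq : Alg.maxd (matrix G) n = maxDeg G := by
  unfold Alg.maxd
  refine card_filter_range_lt fun i => ?_
  constructor
  · rintro ⟨-, v, hv, h⟩
    have := deg_eq G ⟨v, hv⟩
    simp only at this
    rw [this] at h
    exact h.trans (degree_le_maxDeg G _)
  · intro h
    rcases Nat.eq_zero_or_pos n with rfl | hn
    · have : maxDeg G = 0 := by simp [maxDeg]
      omega
    · have : Nonempty (Fin n) := ⟨⟨0, hn⟩⟩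
      obtain ⟨v, hv⟩ := G.exists_maximal_degree_vertex
      have h1 : maxDeg G = G.degree v := hv
      have h2 : G.degree v < n := by simpa using G.degree_lt_card_verts v
      exact ⟨by omega, v, v.2, by rw [deg_eq]; omega⟩

theorem cand_iff (v : Fin n) : Alg.cand (matrix G) n v ↔
    mDegree G ≤ G.degree v + 1 ∨ ∃ u, G.Adj v u ∧ mDegree G ≤ G.degree u + 1 := by
  rw [Alg.cand, mdeg_eq, deg_eq]
  refine or_congr Iff.rfl ⟨?_, ?_⟩
  · rintro ⟨u, hu, h1, h2⟩
    exact ⟨⟨u, hu⟩, (adj_iff G v ⟨u, hu⟩).1 h1, (deg_eq G ⟨u, hu⟩) ▸ h2⟩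
  · rintro ⟨u, h1, h2⟩
    exact ⟨u, u.2, (adj_iff G v u).2 h1, (deg_eq G u).symm ▸ h2⟩

theorem check_iff (P t : ℕ) : Alg.check (matrix G) n P t ↔
    IsCert G fun v (j : Fin (mDegree G)) => Alg.col (matrix G) n P t v j := by
  unfold Alg.check IsCert
  rw [mdeg_eq]
  simp only [← adj_iff, ← deg_eq, Fin.forall_iff, Fin.exists_iff, Fin.ext_iff, ne_eq,
    exists_prop]

/-- Candidates lie in the closed neighborhood of the vertices of degree at least m(G) - 1, so with y
= Δ + 1 there are at most 2y^4 · y of them. Since 2 ≤ 2^y and y < 2^y, this is at most (2^y)^6,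
whence the factor 6 in `Alg.width`. -/
theorem rank_lt (h : numDegGe G (mDegree G) ≤ 2 * (maxDeg G + 1) ^ 4) (v : Fin n)
    (hv : Alg.cand (matrix G) n v) : Alg.rank (matrix G) n v < 2 ^ Alg.width (matrix G) n := by
  have h1 : Alg.rank (matrix G) n v <
      ((Finset.range n).filter fun u => Alg.cand (matrix G) n u).card := by
    refine Finset.card_lt_card ⟨?_, fun hs => ?_⟩
    · exact Finset.filter_subset_filter _ (Finset.range_subset_range.2 v.2.le)
    · have := hs (Finset.mem_filter.2 ⟨Finset.mem_range.2 v.2, hv⟩)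
      simp at this
  refine h1.trans_le ?_
  rw [card_filter_range]
  have h2 : (Finset.univ.filter fun v : Fin n => Alg.cand (matrix G) n v) ⊆
      nbhd G (Finset.univ.filter fun v => mDegree G ≤ G.degree v + 1) := by
    intro v hv
    rcases (cand_iff G v).1 (Finset.mem_filter.1 hv).2 with h | ⟨u, hu, h⟩
    · exact mem_nbhd.2 ⟨v, by simpa using h, Or.inl rfl⟩
    · exact mem_nbhd.2 ⟨u, by simpa using h, Or.inr hu.symm⟩
  refine ((Finset.card_le_card h2).trans (card_nbhd_le (degree_le_maxDeg G) _)).trans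
    ((Nat.mul_le_mul_right _ h).trans ?_)
  rw [Alg.width, maxd_eq, mul_comm 6, pow_mul]
  have h3 : maxDeg G + 1 < 2 ^ (maxDeg G + 1) := Nat.lt_two_pow_self
  set y := maxDeg G + 1
  have h4 : 2 ≤ 2 ^ y := by omega
  calc 2 * y ^ 4 * y ≤ 2 ^ y * (2 ^ y) ^ 4 * 2 ^ y :=
        Nat.mul_le_mul (Nat.mul_le_mul h4 (Nat.pow_le_pow_left h3.le 4)) h3.le
    _ = (2 ^ y) ^ 6 := by ring

/-- On candidates the rank is strictly increasing, since a smaller candidate is counted by the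
larger one but not by itself. -/
theorem rank_inj (u v : Fin n) (hu : Alg.cand (matrix G) n u) (hv : Alg.cand (matrix G) n v)
    (h : Alg.rank (matrix G) n u = Alg.rank (matrix G) n v) : u = v := by
  have key : ∀ u v : Fin n, Alg.cand (matrix G) n u → u < v →
      Alg.rank (matrix G) n u < Alg.rank (matrix G) n v := by
    intro u v hu huv
    refine Finset.card_lt_card ⟨?_, fun hs => ?_⟩
    · exact Finset.filter_subset_filter _ (Finset.range_subset_range.2 (le_of_lt huv))
    · have := hs (Finset.mem_filter.2 ⟨Finset.mem_range.2 huv, hu⟩)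
      simp at this
  rcases lt_trichotomy u v with h' | h' | h'
  · exact absurd h (key u v hu h').ne
  · exact h'
  · exact absurd h (key v u hv h').ne'

/-- Every list of numbers below `2 ^ b` is the list of digits of a number. -/
theorem exists_digits (b L : ℕ) (f : Fin L → ℕ) (hf : ∀ j, f j < 2 ^ b) :
    ∃ t < 2 ^ (b * L), ∀ j : Fin L, t / 2 ^ (b * j) % 2 ^ b = f j := by
  let e : Fin ((2 ^ b) ^ L) := finFunctionFinEquiv fun j => (⟨f j, hf j⟩ : Fin (2 ^ b))
  refine ⟨e, by rw [pow_mul]; exact e.2, fun j => ?_⟩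
  have := congrFun (finFunctionFinEquiv.symm_apply_apply
    fun j => (⟨f j, hf j⟩ : Fin (2 ^ b))) j
  rw [pow_mul]
  exact congrArg Fin.val this

/-- Soundness holds for any `t` that passes the check, whatever it encodes. Completeness encodes the
lists of `exists_lists` as digits, and the candidate bound needed for this is the failure of the
first alternative. -/
theorem answer_iff : Alg.answer (matrix G) n (2 ^ Alg.bits (matrix G) n) ↔
    HasBColoring G (mDegree G) := by
  have hpow : 2 * ((maxDeg G + 1) * (maxDeg G + 1) * ((maxDeg G + 1) * (maxDeg G + 1))) =
    2 * (maxDeg G + 1) ^ 4 := by ring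
  rw [Alg.answer, maxd_eq, mdeg_eq, numGe_eq, hpow]
  constructor
  · rintro (h | ⟨t, -, ht⟩)
    · exact hasBColoring_of_card (degree_le_maxDeg G) (mDegree_le_maxDeg G)
        (card_high_degree_le G) h
    · exact ((check_iff G _ t).1 ht).hasBColoring
  intro h
  refine or_iff_not_imp_left.2 fun hD => ?_
  rw [not_lt] at hD
  obtain ⟨w, hw, hC⟩ := h.exists_lists (card_high_degree_le G)
  have hcand : ∀ j i, Alg.cand (matrix G) n (w j i) := fun j i => (cand_iff G _).2 (hw j i)
  obtain ⟨t, ht, hdig⟩ := exists_digits (Alg.width (matrix G) n)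
    ((mDegree G + mDegree G) * mDegree G)
    (fun x => Alg.rank (matrix G) n (w (finProdFinEquiv.symm x).2 (finProdFinEquiv.symm x).1))
    fun x => rank_lt G hD _ (hcand _ _)
  have hbits : Alg.bits (matrix G) n =
      Alg.width (matrix G) n * ((mDegree G + mDegree G) * mDegree G) := by
    rw [Alg.bits, mdeg_eq]
  have hdig' : ∀ (i : Fin (mDegree G + mDegree G)) (j : Fin (mDegree G)),
      Alg.digit (matrix G) n (2 ^ Alg.bits (matrix G) n) t (i * mDegree G + j) =
        Alg.rank (matrix G) n (w j i) := by
    intro i j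
    have h1 := hdig (finProdFinEquiv (i, j))
    rw [Equiv.symm_apply_apply] at h1
    have h2 : ((finProdFinEquiv (i, j) : Fin _) : ℕ) = i * mDegree G + j := by
      rw [finProdFinEquiv_apply_val]; ring
    have h3 := (finProdFinEquiv (i, j)).2
    rw [h2] at h1 h3
    -- The caps in `Alg.digit` are inactive: both exponents are at most the total number of bits.
    rw [Alg.digit, hbits, min_eq_left, min_eq_left, h1]
    · exact Nat.pow_le_pow_right (by norm_num) (Nat.le_mul_of_pos_right _ (by omega))
    · exact Nat.pow_le_pow_right (by norm_num) (Nat.mul_le_mul_left _ h3.le)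
  refine ⟨t, hbits ▸ ht, (check_iff G _ t).2 ?_⟩
  convert hC using 3 with v j
  rw [Alg.col, mdeg_eq]
  constructor
  · rintro ⟨hv, i, hi, he⟩
    rw [hdig' ⟨i, hi⟩ j] at he
    exact ⟨⟨i, hi⟩, rank_inj G _ _ (hcand _ _) hv he⟩
  · rintro ⟨i, rfl⟩
    exact ⟨hcand _ _, i, i.2, hdig' i j⟩

end

end BCol

namespace BCol
open Classical Polynomial

/-! ### The program and its running time -/

/-- Computing a power of two by repeated doubling. -/
theorem runs_doubling (k : ℕ) : ∀ i s, i + k = s.reg 1 → s.reg 3 = i → s.reg 4 = 1 →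
    ∃ t s', Runs (.loop 3 1 (.seq (.add 2 2 2) (.add 3 3 4))) s t s' ∧ t ≤ 3 * k + 1 ∧
      s'.reg 2 = 2 ^ k * s.reg 2 ∧ s'.reg 0 = s.reg 0 ∧ s'.arr = s.arr := by
  induction k with
  | zero => exact fun i s h1 h3 _ => ⟨1, s, Runs.loop_done (by omega), by omega, by simp, rfl, rfl⟩
  | succ k ih =>
    intro i s h1 h3 h4
    obtain ⟨t, s', r, ht, e2, e0, ea⟩ := ih (i + 1)
      ((s.setReg 2 (s.reg 2 + s.reg 2)).setReg 3 (s.reg 3 + s.reg 4))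
      (by simp [State.setReg]; omega) (by simp [State.setReg, h3, h4]) (by simpa [State.setReg])
    refine ⟨_, s', Runs.loop_step (by omega) ((Runs.add _ _ _ _).seq (Runs.add _ _ _ _)) r,
      by omega, ?_, ?_, ?_⟩
    · rw [e2]; simp [State.setReg]; ring
    · rw [e0]; simp [State.setReg]
    · rw [ea]; rfl

/-- One program decides whether there is a b-coloring with `m(G)` colors, in time polynomial in
`n` and `2 ^ bits`. -/
theorem exists_decider : ∃ (p : Prog) (c : ℕ),
    DecidesInTime p (fun G => HasBColoring G (mDegree G))
      (fun {n} G => c * (n + 2 ^ (12 * (maxDeg G + 1) * mDegree G ^ 2) + 1) ^ c) := by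
  obtain ⟨q₁, hq₁, hp₁⟩ := PT.bits PT.nat
  obtain ⟨q₂, -, hp₂⟩ := PTP.answer (PT.nat.weaken (Γ := ℕ)) PT.snd
  obtain ⟨p₁, hp₁⟩ := hp₁ id 1 fun i hi => hi
  obtain ⟨p₂, hp₂⟩ := hp₂ (Function.update id 1 2) 3
    (lt_update (Γ := ℕ) (d := 1) (fun i hi => hi) (by omega) (by omega))
  -- The summands pay for computing the number of bits, for the doubling loop (three steps per bit),
  -- for the search, and for the remaining single instructions.
  obtain ⟨c, hc⟩ := eval_le_pow ((q₁ + 3 * q₁ + q₂ + 10).comp (X + 1))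
  -- Registers: 0 holds n, 1 the number of bits, 2 the power of two, 3 the loop counter and later
  -- the answer. Registers 2 to 4 are set explicitly because `p₁` may have used them as scratch
  -- space.
  refine ⟨.seq p₁ (.seq (.seq (.const 2 1) (.seq (.const 3 0) (.const 4 1)))
    (.seq (.loop 3 1 (.seq (.add 2 2 2) (.add 3 3 4)))
      (.seq p₂ (.seq (.const 4 0) (.add 0 3 4))))), c, fun n G => ?_⟩
  have hE : Alg.bits (matrix G) n = 12 * (maxDeg G + 1) * mDegree G ^ 2 := by
    rw [Alg.bits, Alg.width, maxd_eq, mdeg_eq]; ring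
  set E := Alg.bits (matrix G) n with hEdef
  beta_reduce
  rw [← hE]
  -- The bound `n + 1` also dominates the matrix entries, which are at most 1.
  have hb : Bdd (n + 1) (matrix G) n :=
    ⟨fun i => (matrix_le_one G i).trans (by omega), fun i _ => Nat.le_succ n⟩
  have hh : Holds id (matrix G) n (inputState G) := by
    refine ⟨rfl, fun i hi => ?_⟩
    obtain rfl : i = 0 := Nat.lt_one_iff.1 hi
    rfl
  obtain ⟨t₁, s₁, r₁, ht₁, e₁, f₁, a₁⟩ := hp₁ _ _ _ _ hb hh
  set s₂ := ((s₁.setReg 2 1).setReg 3 0).setReg 4 1 with hs₂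
  obtain ⟨t₃, s₃, r₃, ht₃, e₃, f₃, a₃⟩ := runs_doubling E 0 s₂
    (by simp [hs₂, State.setReg, e₁, hEdef]) (by simp [hs₂, State.setReg])
    (by simp [hs₂, State.setReg])
  have h0 : s₃.reg 0 = n := by
    rw [f₃]
    simp only [hs₂, State.setReg]
    exact (f₁ 0 Nat.one_pos).trans (show (if 0 = 0 then n else 0) = n from if_pos rfl)
  have h2 : s₃.reg 2 = 2 ^ E := by rw [e₃]; simp [hs₂, State.setReg]
  have ha : s₃.arr 0 = matrix G := by
    rw [a₃]; change s₁.arr 0 = _; rw [a₁]; rfl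
  have hh' : Holds (Function.update id 1 2) (matrix G) (n, 2 ^ E) s₃ :=
    Holds.extend (Γ := ℕ) (π := id) (γ := n) ⟨ha, fun i hi => by
      obtain rfl : i = 0 := Nat.lt_one_iff.1 hi
      exact h0⟩ _ h2
  have hb' : Bdd (n + 2 ^ E + 1) (matrix G) (n, 2 ^ E) :=
    (hb.mono (by omega)).extend (by omega)
  obtain ⟨t₄, s₄, r₄, ht₄, e₄, -, -⟩ := hp₂ _ _ _ _ hb' hh'
  refine ⟨_, _, r₁.seq (((Runs.const _ _ _).seq ((Runs.const _ _ _).seq (Runs.const _ _ _))).seq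
    (r₃.seq (r₄.seq ((Runs.const _ _ _).seq (Runs.add _ _ _ _))))), ?_, ?_, ?_⟩
  · refine le_trans ?_ (hc (n + 2 ^ E))
    have m₁ : q₁.eval (n + 1) ≤ q₁.eval (n + 2 ^ E + 1) := eval_mono_nat q₁ (by omega)
    have m₂ : E ≤ q₁.eval (n + 1) := hq₁ _ _ _ hb
    simp only [eval_comp, eval_add, eval_mul, eval_X, eval_one, eval_ofNat]
    omega
  · intro h
    simpa [State.setReg, e₄] using (answer_iff G).2 h
  · intro h
    simpa [State.setReg, e₄] using fun h' => h ((answer_iff G).1 h')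

/-! ### Estimates for the running time. -/

theorem mDegree_pos {n : ℕ} (G : SimpleGraph (Fin n)) (h : 0 < maxDeg G) : 1 ≤ mDegree G := by
  refine (isGreatest_mDegree G).2 (show 1 ≤ numDegGe G 1 from ?_)
  rcases Nat.eq_zero_or_pos n with rfl | hn
  · simp [maxDeg] at h
  · exact Finset.card_pos.2 ⟨⟨0, hn⟩, by simp⟩

/-- A polynomial in a sum is at most a sum of polynomials. -/
theorem mul_add_pow_le (c n P : ℕ) :
    c * (n + P + 1) ^ c ≤ c * 3 ^ c * (n ^ c + 1) + c * 3 ^ c * P ^ c := by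
  have h : (n + P + 1) ^ c ≤ 3 ^ c * (n ^ c + P ^ c + 1) := by
    have key : ∀ x, n + P + 1 ≤ 3 * x → x ^ c ≤ n ^ c + P ^ c + 1 →
        (n + P + 1) ^ c ≤ 3 ^ c * (n ^ c + P ^ c + 1) := fun x h1 h2 => by
      calc (n + P + 1) ^ c ≤ (3 * x) ^ c := Nat.pow_le_pow_left h1 c
        _ ≤ _ := by rw [mul_pow]; exact Nat.mul_le_mul_left _ h2
    by_cases h1 : n ≤ 1 ∧ P ≤ 1
    · exact key 1 (by omega) (by simp)
    · rcases le_total n P with h2 | h2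
      · exact key P (by omega) (by omega)
      · exact key n (by omega) (by omega)
  calc c * (n + P + 1) ^ c ≤ c * (3 ^ c * (n ^ c + P ^ c + 1)) := Nat.mul_le_mul_left _ h
    _ = _ := by ring

theorem pow_le_pow_add_one (n : ℕ) {a b : ℕ} (h : a ≤ b) : n ^ a ≤ n ^ b + 1 := by
  rcases Nat.eq_zero_or_pos n with rfl | hn
  · rcases Nat.eq_zero_or_pos a with rfl | ha
    · simp
    · simp [ha.ne']
  · exact (Nat.pow_le_pow_right hn h).trans (Nat.le_succ _)

theorem DecidesInTime.mono {p : Prog} {Q : ∀ {n : ℕ}, SimpleGraph (Fin n) → Prop}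
    {T T' : ∀ {n : ℕ}, SimpleGraph (Fin n) → ℕ} (h : DecidesInTime p Q T)
    (hT : ∀ (n : ℕ) (G : SimpleGraph (Fin n)), T G ≤ T' G) : DecidesInTime p Q T' := fun n G => by
  obtain ⟨t, s, r, ht, h1⟩ := h n G
  exact ⟨t, s, r, ht.trans (hT n G), h1⟩

/-- For Δ ≥ 1 one has Δ + 1 ≤ 2Δ and k² ≤ k⁴, so the exponent 12(Δ+1)k² is at most 24k⁴Δ, and the
factor `K` moves into the exponent by `K ≤ 2 ^ K`. For Δ = 0 the target exponent vanishes; then k ≤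
1 and the search cost is a constant, charged to the polynomial term. -/
theorem exists_decider_mDegree : ∃ (p : Prog) (c : ℕ),
    DecidesInTime p (fun G => HasBColoring G (mDegree G))
      (fun {n} G => 2 ^ (c * (mDegree G ^ 4 * maxDeg G)) + c * (n ^ c + 1)) := by
  obtain ⟨p, c, h⟩ := exists_decider
  set K := c * 3 ^ c with hK
  refine ⟨p, 2 * K + K * 2 ^ (12 * c) + 24 * c, h.mono fun n G => ?_⟩
  set C := 2 * K + K * 2 ^ (12 * c) + 24 * c with hC
  have hn : n ^ c ≤ n ^ C + 1 := pow_le_pow_add_one n (by omega)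
  refine (mul_add_pow_le c n _).trans ?_
  rw [← hK, ← pow_mul]
  have h1 : K * (n ^ c + 1) ≤ 2 * K * (n ^ C + 1) :=
    calc K * (n ^ c + 1) ≤ K * (2 * (n ^ C + 1)) := Nat.mul_le_mul_left _ (by omega)
      _ = _ := by ring
  rcases Nat.eq_zero_or_pos (maxDeg G) with hΔ | hΔ
  · have hk : mDegree G ^ 2 ≤ 1 := by
      have := mDegree_le_maxDeg G
      exact pow_le_one₀ (Nat.zero_le _) (by omega)
    have h2 : 2 ^ (12 * (maxDeg G + 1) * mDegree G ^ 2 * c) ≤ 2 ^ (12 * c) :=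
      Nat.pow_le_pow_right (by norm_num) (Nat.mul_le_mul_right _ (by rw [hΔ]; omega))
    calc _ ≤ 2 * K * (n ^ C + 1) + K * 2 ^ (12 * c) * (n ^ C + 1) :=
          add_le_add h1 ((Nat.mul_le_mul_left _ h2).trans (Nat.le_mul_of_pos_right _ (by omega)))
      _ = (2 * K + K * 2 ^ (12 * c)) * (n ^ C + 1) := by ring
      _ ≤ C * (n ^ C + 1) := Nat.mul_le_mul_right _ (by omega)
      _ ≤ _ := Nat.le_add_left _ _
  · have hk := mDegree_pos G hΔ
    set X := mDegree G ^ 4 * maxDeg G with hX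
    have hX1 : 1 ≤ X := Nat.mul_pos (Nat.pow_pos hk) hΔ
    have hE : 12 * (maxDeg G + 1) * mDegree G ^ 2 * c ≤ 24 * c * X :=
      calc 12 * (maxDeg G + 1) * mDegree G ^ 2 * c
          ≤ 12 * (2 * maxDeg G) * mDegree G ^ 4 * c :=
            Nat.mul_le_mul_right _ (Nat.mul_le_mul (Nat.mul_le_mul_left _ (by omega))
              (Nat.pow_le_pow_right hk (by norm_num)))
        _ = _ := by rw [hX]; ring
    have h2 : K * 2 ^ (12 * (maxDeg G + 1) * mDegree G ^ 2 * c) ≤ 2 ^ (C * X) :=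
      calc _ ≤ 2 ^ K * 2 ^ (24 * c * X) :=
            Nat.mul_le_mul Nat.lt_two_pow_self.le (Nat.pow_le_pow_right (by norm_num) hE)
        _ = 2 ^ (K + 24 * c * X) := (pow_add _ _ _).symm
        _ ≤ _ := Nat.pow_le_pow_right (by norm_num) (by
            calc K + 24 * c * X ≤ K * X + 24 * c * X :=
                  Nat.add_le_add_right (Nat.le_mul_of_pos_right _ hX1) _
              _ = (K + 24 * c) * X := by ring
              _ ≤ C * X := Nat.mul_le_mul_right _ (by omega))
    calc _ ≤ C * (n ^ C + 1) + 2 ^ (C * X) :=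
          add_le_add (h1.trans (Nat.mul_le_mul_right _ (by omega))) h2
      _ = _ := add_comm _ _

theorem DecidesInTime.of_mDegree {p : Prog} {Q : ∀ {n : ℕ}, SimpleGraph (Fin n) → Prop} {c : ℕ}
    (h : DecidesInTime p Q
      (fun {n} G => 2 ^ (c * (mDegree G ^ 4 * maxDeg G)) + c * (n ^ c + 1))) :
    DecidesInTime p Q
      (fun {n} G => 2 ^ (16 * c * maxDeg G ^ 5) + 16 * c * (n ^ (16 * c) + 1)) := by
  refine h.mono fun n G => add_le_add (Nat.pow_le_pow_right (by norm_num) ?_) ?_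
  · rcases Nat.eq_zero_or_pos (maxDeg G) with hΔ | hΔ
    · simp [hΔ]
    · have h1 : mDegree G ≤ 2 * maxDeg G := (mDegree_le_maxDeg G).trans (by omega)
      calc c * (mDegree G ^ 4 * maxDeg G) ≤ c * ((2 * maxDeg G) ^ 4 * maxDeg G) :=
            Nat.mul_le_mul_left _ (Nat.mul_le_mul_right _ (Nat.pow_le_pow_left h1 4))
        _ = _ := by ring
  · have h1 : n ^ c ≤ n ^ (16 * c) + 1 := pow_le_pow_add_one n (by omega)
    calc c * (n ^ c + 1) ≤ c * (16 * (n ^ (16 * c) + 1)) := Nat.mul_le_mul_left _ (by omega)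
      _ = _ := by ring

theorem computable_bound (c : ℕ) : Computable fun d : ℕ => 2 ^ (c * d ^ 5) + 2 * c := by
  have hmul : Primrec fun d : ℕ => c * d ^ 5 := by
    have h2 := Primrec.nat_mul.comp (Primrec.id (α := ℕ)) Primrec.id
    have h4 := Primrec.nat_mul.comp h2 h2
    exact (Primrec.nat_mul.comp (Primrec.const c) (Primrec.nat_mul.comp h4 Primrec.id)).of_eq
      fun d => by simp only [id]; ring
  have hpow : Primrec fun m : ℕ => 2 ^ m :=
    (Primrec.nat_rec₁ 1 (Primrec.nat_mul.comp (Primrec.const 2) Primrec.snd).to₂).of_eq fun m => by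
      induction m with
      | zero => rfl
      | succ m ih => rw [pow_succ, ← ih, mul_comm]
  exact (Primrec.nat_add.comp (hpow.comp hmul) (Primrec.const (2 * c))).to_comp

/-- A sum of a function of the parameter and a polynomial is at most a product of such terms, since
the input size is at least 1. -/
theorem DecidesInTime.isFPT {p : Prog} {Q : ∀ {n : ℕ}, SimpleGraph (Fin n) → Prop} {c : ℕ}
    (h : DecidesInTime p Q (fun {n} G => 2 ^ (c * maxDeg G ^ 5) + c * (n ^ c + 1))) :
    IsFPT Q (fun G => maxDeg G) := by
  refine ⟨p, _, c, computable_bound c, h.mono fun n G => ?_⟩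
  have h1 : 1 ≤ (n ^ 2 + 1) ^ c := Nat.one_le_pow _ _ (by omega)
  have h2 : n ^ c ≤ (n ^ 2 + 1) ^ c := Nat.pow_le_pow_left (by nlinarith) c
  change _ ≤ _ * (n ^ 2 + 1) ^ c
  rw [add_mul]
  refine add_le_add (Nat.le_mul_of_pos_right _ h1) ?_
  calc c * (n ^ c + 1) ≤ c * (2 * (n ^ 2 + 1) ^ c) := Nat.mul_le_mul_left _ (by omega)
    _ = _ := by ring

end BCol

theorem mainTheorem8 :
    (∃ p : BCol.Prog,
      (∃ c : ℕ, BCol.DecidesInTime p (fun G => BCol.HasBColoring G (BCol.mDegree G))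
        (fun {n} G => 2 ^ (c * (BCol.mDegree G ^ 4 * BCol.maxDeg G)) + c * (n ^ c + 1))) ∧
      (∃ c : ℕ, BCol.DecidesInTime p (fun G => BCol.HasBColoring G (BCol.mDegree G))
        (fun {n} G => 2 ^ (c * BCol.maxDeg G ^ 5) + c * (n ^ c + 1)))) ∧
    BCol.IsFPT (fun G => BCol.HasBColoring G (BCol.mDegree G)) (fun G => BCol.maxDeg G) := by
  obtain ⟨p, c, h⟩ := BCol.exists_decider_mDegree
  exact ⟨⟨p, ⟨c, h⟩, 16 * c, h.of_mDegree⟩, h.of_mDegree.isFPT⟩
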